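/- Setting. Let $m\ge 1$ and $N\ge 1$ and $k_{\max}\ge 0$ be integers with $k_{\max}+1\le N\sqrt3/4$, and let $\lambda,P_t,f,z>0$, $\alpha>2$ and $0\le r_e<\tau$. Base stations form a homogeneous Poisson point process $\Psi=\{X_i\}$ of density $\lambda$ on the annulus $\{x\in\mathbb R^2: r_e\le |x|\le\tau\}$. Independently of $\Psi$, the stations carry independent marks: a beam angle $\xi_i$, uniform on $[-\pi/3,\pi/3)$, and, independent of it, a channel $h_i$ with $|h_i|^2$ gamma-distributed with shape $m$ and scale $1/m$. With $\kappa=(4\pi f/c_0)^2$ and $c_0$ the speed of light, let $$\bar S_r(r)=\frac{P_t\kappa}{4\pi}\,\kappa^{-1}(r^2+z^2)^{-\alpha/2}.$$ Let $\chi_0=1$ and, for $1\le k\le k_{\max}$, $\chi_k=\frac{\sin^2(Nx_k)}{N^2\sin^2 x_k}$, where $x_k$ is the $k$-th positive solution of $N\tan x=\tan(Nx)$ (the unique one in $(k\pi/N,(k+1)\pi/N)$). The antenna gain is $G(\varphi)=\cos^2(N\pi\varphi/4)$ for $|\varphi|\le 2/N$, $G(\varphi)=\chi_k\sin^2(N\pi\varphi/2)$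 for $2k/N\le|\varphi|\le(2k+2)/N$ with $1\le k\le k_{\max}$, and $G(\varphi)=0$ for $|\varphi|\ge(2k_{\max}+2)/N$. The exposure of a user at the origin is $\mathcal S=\sum_i\bar S_r(|X_i|)\,G(\xi_i)\,|h_i|^2$. Its CDF is $F_{emf}(T)=\mathbb P[\mathcal S<T]$, its CDF conditioned on $\Psi$ is $F_{emf}(T|\Psi)=\mathbb P[\mathcal S<T\mid\Psi]$, and $\mathcal M_1(T)=\mathbb E_\Psi[F_{emf}(T|\Psi)]$. Theorem. For every $T_e\in\mathbb R$, $\mathcal M_1(T_e)=F_{emf}(T_e)$, and for every $T_e\neq0$ (in particular every $T_e>0$) $$\mathcal M_1(T_e)=F_{emf}(T_e)=\frac12-\frac1\pi\int_0^\infty \mathrm{Im}\!\left[\phi_E(q)\,e^{-jqT_e}\right]q^{-1}\,dq,$$ where $j$ is the imaginary unit and the integral is $\lim_{R\to\infty}\int_0^R$, the integrand being integrable on each $(0,R)$. Here $\phi_E(q)=\mathbb E[e^{jq\mathcal S}]$ is the unconditional characteristic function of $\mathcal S$, which for every real $q\ne0$ equals $$\phi_E(q)=\exp\!\left(-\frac{6\lambda(1+k_{\max})}{N}\big[r^2\big]_{r=r_e}^{r=\tau}-\frac{24\lambda}{N}\sum_{k=0}^{k_{\max}}\sum_{l=0}^{m-1}\left[\frac{\binom{-1/2}{l}\binom{m-1}{l}(r^2+z^2)\;{}_2F_1\!\left(1,\,1-l+\frac2\alpha;\,\frac12-l+m+\frac2\alpha;\,\frac1{c_k(q,r)}\right)}{\big(4+\alpha(2m-2l-1)\big)\,c_k(q,r)^{1-l}\,\big(1-c_k(q,r)\big)^{m-3/2}}\right]_{r=r_e}^{r=\tau}\right),$$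 with $c_k(q,r)=jq\chi_k\bar S_r(r)/m$, $[g(r)]_{r=a}^{r=b}=g(b)-g(a)$, principal branches of the powers, and ${}_2F_1$ the Gauss hypergeometric function on $\mathbb C\setminus[1,\infty)$. -/

import Mathlib

open MeasureTheory ProbabilityTheory Filter Topology

noncomputable section

/-! ### Finite Poisson point processes -/

section PointProcess

variable {Ω E : Type*}

/-- A finite point process is given by its number of points `n` and an enumeration
`X 0, …, X (n - 1)` of them.  `pointCount n X B` is the number of points in `B`. -/
def pointCount (n : Ω → ℕ) (X : ℕ → Ω → E) (B : Set E) (ω : Ω) : ℕ :=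
  open Classical in ((Finset.range (n ω)).filter (fun i => X i ω ∈ B)).card

/-- The σ-algebra generated by the point process, i.e. by the counts of its points in
measurable sets. -/
@[reducible] def pointSigma [MeasurableSpace E] (n : Ω → ℕ) (X : ℕ → Ω → E) : MeasurableSpace Ω :=
  ⨆ (B : Set E) (_ : MeasurableSet B), MeasurableSpace.comap (pointCount n X B) ⊤

/-- `(n, X)` is a Poisson point process with finite intensity measure `Λ`: the number of points
in `B` is Poisson with mean `Λ B`, and the numbers of points in disjoint sets are independent. -/
structure IsPoissonProcess [MeasurableSpace Ω] [MeasurableSpace E] (μ : Measure Ω)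
    (Λ : Measure E) [IsFiniteMeasure Λ] (n : Ω → ℕ) (X : ℕ → Ω → E) : Prop where
  measurable_card : Measurable n
  measurable_point : ∀ i, Measurable (X i)
  count_law : ∀ B : Set E, MeasurableSet B →
    HasLaw (pointCount n X B) (poissonMeasure (Λ B).toNNReal) μ
  count_indep : ∀ (k : ℕ) (B : Fin k → Set E), (∀ i, MeasurableSet (B i)) →
    Pairwise (Function.onFun Disjoint B) → iIndepFun (fun i => pointCount n X (B i)) μ

end PointProcess

/-! ### Antenna pattern -/

/-- The argument `x_k` of the maximum of the `k`-th side lobe (`k ≥ 1`) of the array factor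
`sin² (N x) / (N² sin² x)`, i.e. the `k`-th positive solution of `N tan x = tan (N x)`.  For
`k + 1 ≤ N / 2` there is exactly one solution between the consecutive zeros `k π / N` and
`(k + 1) π / N` of the array factor (and none in `(0, π / N)`); the infimum selects it. -/
def lobeArg (N k : ℕ) : ℝ :=
  sInf {x : ℝ | k * Real.pi / N < x ∧ x < (k + 1) * Real.pi / N ∧
    N * Real.tan x = Real.tan (N * x)}

/-- The height `χ_k` of the `k`-th lobe, with `χ_0 = 1` for the main lobe. -/
def lobePeak (N k : ℕ) : ℝ :=
  if k = 0 then 1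
  else Real.sin (N * lobeArg N k) ^ 2 / ((N : ℝ) ^ 2 * Real.sin (lobeArg N k) ^ 2)

/-- The multi-cosine antenna gain with `kmax` side lobes on each side; it vanishes beyond the
last side lobe. -/
def multiCosGain (N kmax : ℕ) (φ : ℝ) : ℝ :=
  if |φ| ≤ 2 / N then Real.cos (N * Real.pi * φ / 4) ^ 2
  else if |φ| < (2 * kmax + 2) / N then
    lobePeak N ⌊N * |φ| / 2⌋₊ * Real.sin (N * Real.pi * φ / 2) ^ 2
  else 0

/-! ### Network model -/

/-- Speed of light in m/s. -/
def lightSpeed : ℝ := 299792458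

/-- The parameters of the network. -/
structure NetworkParams where
  /-- number of antennas of each linear array -/
  N : ℕ
  /-- number of side lobes kept in the antenna pattern -/
  kmax : ℕ
  /-- Nakagami parameter -/
  m : ℕ
  /-- density of base stations -/
  lam : ℝ
  /-- maximum transmit power -/
  Pt : ℝ
  /-- carrier frequency -/
  f : ℝ
  /-- path loss exponent -/
  α : ℝ
  /-- height of the base stations -/
  z : ℝ
  /-- exclusion radius -/
  re : ℝ
  /-- radius of the network area -/
  τ : ℝ

namespace NetworkParams

/-- Standing assumptions on the parameters.  The one on `kmax` keeps the lobes inside the sector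
served by one array. -/
structure Admissible (p : NetworkParams) : Prop where
  m_pos : 1 ≤ p.m
  lam_pos : 0 < p.lam
  Pt_pos : 0 < p.Pt
  f_pos : 0 < p.f
  α_gt : 2 < p.α
  z_pos : 0 < p.z
  re_nonneg : 0 ≤ p.re
  re_lt : p.re < p.τ
  lobes : (p.kmax : ℝ) + 1 ≤ p.N * Real.sqrt 3 / 4

variable (p : NetworkParams)

/-- `κ = (4 π f / c₀)²`. -/
def κ : ℝ := (4 * Real.pi * p.f / lightSpeed) ^ 2

/-- Path loss attenuation at horizontal distance `r`. -/
def pathLoss (r : ℝ) : ℝ := p.κ⁻¹ * (r ^ 2 + p.z ^ 2) ^ (-p.α / 2)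

/-- Power density `S̄(r)` at horizontal distance `r` from a base station, for unit gain and unit
fading. -/
def Sbar (r : ℝ) : ℝ := p.Pt * p.pathLoss r * p.κ / (4 * Real.pi)

/-- The region containing the base stations: the disk of radius `τ` without the exclusion disk. -/
def region : Set (EuclideanSpace ℝ (Fin 2)) := {x | p.re ≤ ‖x‖ ∧ ‖x‖ ≤ p.τ}

/-- The intensity measure of the base stations: density `lam` on the region. -/
def intensity : Measure (EuclideanSpace ℝ (Fin 2)) :=
  ENNReal.ofReal p.lam • volume.restrict p.region

instance : IsFiniteMeasure p.intensity := by
  have hfin : volume p.region < ⊤ := by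
    refine lt_of_le_of_lt (measure_mono ?_)
      (measure_closedBall_lt_top (x := (0 : EuclideanSpace ℝ (Fin 2))) (r := p.τ))
    intro x hx
    simpa using hx.2
  have : IsFiniteMeasure (volume.restrict p.region) := ⟨by simpa using hfin⟩
  exact Measure.smul_finite _ ENNReal.ofReal_ne_top

/-- The random network.  The base stations `X i`, `i < n`, form a Poisson process.  The marks
`(ξ i, h i)` (beam angle and channel of `X i`) are independent of the base stations and of each
other; `ξ i` is uniform on a sector of width `2 π / 3` centred at the boresight of the array, and
`|h i|²` is gamma-distributed with shape `m` and scale `1 / m`, i.e. rate `m`. -/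
structure IsNetwork {Ω : Type*} [MeasurableSpace Ω] (μ : Measure Ω) (n : Ω → ℕ)
    (X : ℕ → Ω → EuclideanSpace ℝ (Fin 2)) (ξ : ℕ → Ω → ℝ) (h : ℕ → Ω → ℂ) : Prop where
  poisson : IsPoissonProcess μ p.intensity n X
  measurable_angle : ∀ i, Measurable (ξ i)
  measurable_channel : ∀ i, Measurable (h i)
  angle_law : ∀ i, pdf.IsUniform (ξ i) (Set.Ico (-(Real.pi / 3)) (Real.pi / 3)) μ
  fading_law : ∀ i, HasLaw (fun ω => ‖h i ω‖ ^ 2) (gammaMeasure p.m p.m) μ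
  angle_indep_channel : ∀ i, IndepFun (ξ i) (h i) μ
  marks_indep : iIndepFun (fun i ω => (ξ i ω, h i ω)) μ
  points_indep_marks :
    IndepFun (fun ω => (n ω, fun i => X i ω)) (fun ω i => (ξ i ω, h i ω)) μ

section Exposure

variable {Ω : Type*}

/-- The exposure `S = ∑ S̄(|X i|) G(ξ i) |h i|²` of the user at the origin. -/
def exposure (n : Ω → ℕ) (X : ℕ → Ω → EuclideanSpace ℝ (Fin 2)) (ξ : ℕ → Ω → ℝ) (h : ℕ → Ω → ℂ)
    (ω : Ω) : ℝ :=
  ∑ i ∈ Finset.range (n ω), p.Sbar ‖X i ω‖ * multiCosGain p.N p.kmax (ξ i ω) * ‖h i ω‖ ^ 2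

variable [MeasurableSpace Ω] (μ : Measure Ω)

/-- The unconditional CDF `P(S < T)` of the exposure. -/
def exposureCDF (n : Ω → ℕ) (X : ℕ → Ω → EuclideanSpace ℝ (Fin 2)) (ξ : ℕ → Ω → ℝ)
    (h : ℕ → Ω → ℂ) (T : ℝ) : ℝ :=
  μ.real {ω | p.exposure n X ξ h ω < T}

/-- The CDF `P(S < T | Ψ)` of the exposure conditioned on the point process of base stations. -/
def condExposureCDF (n : Ω → ℕ) (X : ℕ → Ω → EuclideanSpace ℝ (Fin 2)) (ξ : ℕ → Ω → ℝ)
    (h : ℕ → Ω → ℂ) (T : ℝ) : Ω → ℝ :=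
  μ[{ω | p.exposure n X ξ h ω < T}.indicator (fun _ => (1 : ℝ)) | pointSigma n X]

/-- The moment of order `b` of the conditional CDF of the exposure. -/
def condCDFMoment (b : ℕ) (n : Ω → ℕ) (X : ℕ → Ω → EuclideanSpace ℝ (Fin 2)) (ξ : ℕ → Ω → ℝ)
    (h : ℕ → Ω → ℂ) (T : ℝ) : ℝ :=
  ∫ ω, p.condExposureCDF μ n X ξ h T ω ^ b ∂μ

end Exposure

end NetworkParams

/-! ### Closed form of the characteristic function -/

/-- The Gauss hypergeometric function `₂F₁(a, b; c; w)` for `w ∉ [1, ∞)` and `0 < a < c`, by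
Euler's integral
`Γ(c) / (Γ(a) Γ(c - a)) ∫₀¹ t ^ (a - 1) (1 - t) ^ (c - a - 1) (1 - t w) ^ (-b) dt`
(`₂F₁` is symmetric in `a` and `b`, and no sign condition on `b` is needed here). -/
def gauss2F1 (a b c : ℝ) (w : ℂ) : ℂ :=
  (Real.Gamma c / (Real.Gamma a * Real.Gamma (c - a)) : ℝ) *
    ∫ t in (0 : ℝ)..1, ((t ^ (a - 1) * (1 - t) ^ (c - a - 1) : ℝ) : ℂ) *
      (1 - (t : ℂ) * w) ^ (-b : ℂ)

namespace NetworkParams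

variable (p : NetworkParams)

/-- `j q χ_k S̄(r) / m`. -/
def cfArg (k : ℕ) (q r : ℝ) : ℂ :=
  Complex.I * ((q * lobePeak p.N k * p.Sbar r / p.m : ℝ) : ℂ)

/-- The `(k, l)` term of the closed form, before taking the difference of its values at `τ`
and `re`. -/
def cfTerm (k l : ℕ) (q r : ℝ) : ℂ :=
  ((Ring.choose (-1 / 2 : ℝ) l * (p.m - 1).choose l * (r ^ 2 + p.z ^ 2) : ℝ) : ℂ) *
      gauss2F1 1 (1 - l + 2 / p.α) (1 / 2 - l + p.m + 2 / p.α) (1 / p.cfArg k q r) /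
    (((4 + p.α * (2 * p.m - 2 * l - 1) : ℝ) : ℂ) * p.cfArg k q r ^ (1 - (l : ℤ)) *
      (1 - p.cfArg k q r) ^ ((p.m : ℂ) - 3 / 2))

/-- The closed form of the unconditional characteristic function of the exposure. -/
def exposureCF (q : ℝ) : ℂ :=
  Complex.exp (((-6 * p.lam * (1 + p.kmax) / p.N * (p.τ ^ 2 - p.re ^ 2) : ℝ) : ℂ) -
    ((24 * p.lam / p.N : ℝ) : ℂ) *
      ∑ k ∈ Finset.range (p.kmax + 1), ∑ l ∈ Finset.range p.m,
        (p.cfTerm k l q p.τ - p.cfTerm k l q p.re))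

end NetworkParams

end

noncomputable section

/-! ### The Dirichlet integral -/

/-! The identity of the first moment with the CDF is the tower property. The rest is Gil-Pelaez
inversion (`tendsto_gilPelaez`) applied to the law of the exposure $\mathcal S$. That inversion
needs a finite first moment, no atom at $T$, and the characteristic function.

Inversion rests on the Dirichlet integral: $\mathrm{Im}[\phi(q)e^{-jqT}]/q$ is the mean of
$(x-T)\,\mathrm{sinc}(q(x-T))$, and its integral over $(0,R)$ is the mean of a bounded function
tending to $\frac\pi2\mathrm{sign}(x-T)$.

For the characteristic function, the stations and the marks are moved to independent factors of a
product space (`identDistrib_exposure`), so that conditioning on the stations becomes Fubini. Given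
the stations, the summands are independent, and a station at distance $r$ contributes the factor
`pointCF` $(q,r)$. The Poisson generating functional (`IsPoissonProcess.integral_prod`) turns the
mean of the product into $\exp\int(\mathtt{pointCF}-1)\,d\Lambda$.

Two closed forms make this exponent explicit. Averaging the gamma transform $(1-jy\,G)^{-m}$ over
one lobe gives $\frac2\pi\int_0^{\pi/2}(1-jy\sin^2\theta)^{-m}d\theta$, which is $(1-x)^{1/2-m}$
times a polynomial in $x=jy$ (`lobeMean_eq`); the index $l$ runs over its monomials. Each monomial,
with $y$ proportional to $\bar S_r(r)$, has a radial primitive containing ${}_2F_1(1,b;B+1;1/x)$.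
The verification uses a first-order differential equation for this function (`eulerIntegral_ode`,
`hasDerivAt_primitive`).

Atoms can occur only at $0$: a nonzero value requires a gamma variable, which is diffuse, to have
entered the sum (`map_exposure_singleton`). At $0$ there is an atom, since there may be no station
at all, whence $T\ne0$. -/

lemma integral_sin_mul_exp_neg (R t : ℝ) :
    ∫ q in (0 : ℝ)..R, Real.sin q * Real.exp (-q * t) =
      (1 + t ^ 2)⁻¹ - Real.exp (-R * t) * (Real.cos R + t * Real.sin R) / (1 + t ^ 2) := by
  have ht : (1 + t ^ 2) ≠ 0 := by positivity
  have hd : ∀ q : ℝ, HasDerivAt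
      (fun q => -(Real.exp (-q * t) * (Real.cos q + t * Real.sin q) / (1 + t ^ 2)))
      (Real.sin q * Real.exp (-q * t)) q := by
    intro q
    have h1 : HasDerivAt (fun q : ℝ => Real.exp (-q * t)) (Real.exp (-q * t) * (-1 * t)) q :=
      (((hasDerivAt_id q).neg).mul_const t).exp
    have h2 : HasDerivAt (fun q => Real.cos q + t * Real.sin q)
        (-Real.sin q + t * Real.cos q) q :=
      (Real.hasDerivAt_cos q).add ((Real.hasDerivAt_sin q).const_mul t)
    refine ((h1.mul h2).div_const (1 + t ^ 2)).neg.congr_deriv ?_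
    field_simp
    ring
  rw [intervalIntegral.integral_eq_sub_of_hasDerivAt (fun q _ => hd q)
    (Continuous.intervalIntegrable (by fun_prop) _ _)]
  simp
  ring

lemma integral_sin_mul_exp_neg_Ioi {q : ℝ} (hq : 0 < q) :
    ∫ t in Set.Ioi (0 : ℝ), Real.sin q * Real.exp (-q * t) = Real.sinc q := by
  rw [integral_const_mul, integral_exp_mul_Ioi (by linarith), Real.sinc_of_ne_zero hq.ne']
  simp
  rw [div_eq_mul_inv]

lemma integrableOn_exp_neg_mul {q : ℝ} (hq : 0 < q) :
    IntegrableOn (fun t => Real.exp (-q * t)) (Set.Ioi (0 : ℝ)) :=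
  integrableOn_exp_mul_Ioi (by linarith) 0

/-- The singularity at $q=0$ is harmless: integrating the absolute value over $t$ first leaves
$|\mathrm{sinc}\,q|$, which is bounded. -/
lemma integrable_prod_sin_mul_exp_neg (R : ℝ) :
    Integrable (Function.uncurry fun q t : ℝ => Real.sin q * Real.exp (-q * t))
      ((volume.restrict (Set.Ioc 0 R)).prod (volume.restrict (Set.Ioi 0))) := by
  rw [integrable_prod_iff (by
    refine Continuous.aestronglyMeasurable ?_
    unfold Function.uncurry
    fun_prop)]
  constructor
  · filter_upwards [ae_restrict_mem measurableSet_Ioc] with q hq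
    exact (integrableOn_exp_neg_mul hq.1).const_mul (Real.sin q)
  · have : IntegrableOn (fun q => |Real.sinc q|) (Set.Ioc 0 R) :=
      (Real.continuous_sinc.abs.integrableOn_Icc).mono_set Set.Ioc_subset_Icc_self
    refine this.congr ?_
    filter_upwards [ae_restrict_mem measurableSet_Ioc] with q hq
    simp only [Function.uncurry, norm_mul, Real.norm_eq_abs, Real.abs_exp]
    rw [integral_const_mul, integral_exp_mul_Ioi (by linarith [hq.1]),
      Real.sinc_of_ne_zero hq.1.ne', abs_div, abs_of_pos hq.1]
    simp
    rw [div_eq_mul_inv]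

/-- Write $\mathrm{sinc}\,q$ as the Laplace integral of $\sin q\,e^{-qt}$ over $t>0$ and swap. The
term $1/(1+t^2)$ yields $\pi/2$; the remainder carries $e^{-Rt}$ and is $O(1/R)$. -/
lemma integral_sinc_eq {R : ℝ} (hR : 0 < R) :
    ∫ q in (0 : ℝ)..R, Real.sinc q = Real.pi / 2 -
      ∫ t in Set.Ioi (0 : ℝ),
        Real.exp (-R * t) * (Real.cos R + t * Real.sin R) / (1 + t ^ 2) := by
  have hint := integrable_prod_sin_mul_exp_neg R
  have h1 : ∫ q in (0 : ℝ)..R, Real.sinc q =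
      ∫ q in Set.Ioc 0 R, ∫ t in Set.Ioi (0 : ℝ), Real.sin q * Real.exp (-q * t) := by
    rw [intervalIntegral.integral_of_le hR.le]
    refine setIntegral_congr_fun measurableSet_Ioc fun q hq => ?_
    exact (integral_sin_mul_exp_neg_Ioi hq.1).symm
  have h2 : ∀ t : ℝ, ∫ q in Set.Ioc 0 R, Real.sin q * Real.exp (-q * t) =
      (1 + t ^ 2)⁻¹ - Real.exp (-R * t) * (Real.cos R + t * Real.sin R) / (1 + t ^ 2) := by
    intro t
    rw [← intervalIntegral.integral_of_le hR.le, integral_sin_mul_exp_neg]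
  have h3 := hint.integral_prod_right
  simp only [Function.uncurry, h2] at h3
  have h4 : IntegrableOn (fun t : ℝ => (1 + t ^ 2)⁻¹) (Set.Ioi 0) :=
    integrable_inv_one_add_sq.integrableOn
  have h5 : IntegrableOn (fun t : ℝ =>
      Real.exp (-R * t) * (Real.cos R + t * Real.sin R) / (1 + t ^ 2)) (Set.Ioi 0) := by
    refine (h4.sub h3).congr (Eventually.of_forall fun t => ?_)
    simp
  rw [h1, integral_integral_swap hint]
  simp only [h2]
  rw [integral_sub h4 h5, integral_Ioi_inv_one_add_sq]
  simp

lemma abs_integral_sinc_sub_le {R : ℝ} (hR : 0 < R) :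
    |(∫ q in (0 : ℝ)..R, Real.sinc q) - Real.pi / 2| ≤ 2 / R := by
  rw [integral_sinc_eq hR, sub_right_comm, sub_self, zero_sub, abs_neg]
  have h : ∫ t in Set.Ioi (0 : ℝ), 2 * Real.exp (-R * t) = 2 / R := by
    rw [integral_const_mul, integral_exp_mul_Ioi (by linarith)]
    simp
    rw [div_eq_mul_inv]
  rw [← h, ← Real.norm_eq_abs]
  refine norm_integral_le_of_norm_le ((integrableOn_exp_neg_mul hR).const_mul 2) ?_
  filter_upwards [ae_restrict_mem measurableSet_Ioi] with t ht
  have ht : 0 < t := ht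
  rw [Real.norm_eq_abs, abs_div, abs_mul, Real.abs_exp, abs_of_pos (by positivity : 0 < 1 + t ^ 2),
    div_le_iff₀ (by positivity)]
  have h1 : |Real.cos R + t * Real.sin R| ≤ 1 + t := by
    refine (abs_add_le _ _).trans (add_le_add (Real.abs_cos_le_one _) ?_)
    rw [abs_mul, abs_of_pos ht]
    exact mul_le_of_le_one_right ht.le (Real.abs_sin_le_one _)
  have h2 : 1 + t ≤ 2 * (1 + t ^ 2) := by nlinarith [sq_nonneg (t - 1)]
  calc Real.exp (-R * t) * |Real.cos R + t * Real.sin R|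
      ≤ Real.exp (-R * t) * (2 * (1 + t ^ 2)) := by gcongr; exact h1.trans h2
    _ = 2 * Real.exp (-R * t) * (1 + t ^ 2) := by ring

lemma integral_sinc_neg (R : ℝ) :
    ∫ q in (0 : ℝ)..(-R), Real.sinc q = -∫ q in (0 : ℝ)..R, Real.sinc q := by
  have := intervalIntegral.integral_comp_neg (a := 0) (b := R) Real.sinc
  simp only [Real.sinc_neg, neg_zero] at this
  rw [intervalIntegral.integral_symm, this]

lemma tendsto_integral_sinc :
    Tendsto (fun R : ℝ => ∫ q in (0 : ℝ)..R, Real.sinc q) atTop (𝓝 (Real.pi / 2)) := by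
  rw [tendsto_iff_norm_sub_tendsto_zero]
  refine squeeze_zero' (Eventually.of_forall fun _ => norm_nonneg _) ?_
    ((tendsto_const_nhds (x := (2 : ℝ))).div_atTop tendsto_id)
  filter_upwards [eventually_gt_atTop 0] with R hR
  exact abs_integral_sinc_sub_le hR

/-- A bound uniform in $R$, to serve as the dominating constant in the inversion. For $0\le R\le1$
use $|\mathrm{sinc}|\le1$, for $R\ge1$ use $\pi/2+2/R\le4$, and for negative $R$ oddness. -/
lemma abs_integral_sinc_le (R : ℝ) : |∫ q in (0 : ℝ)..R, Real.sinc q| ≤ 4 := by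
  have key : ∀ R : ℝ, 0 ≤ R → |∫ q in (0 : ℝ)..R, Real.sinc q| ≤ 4 := by
    intro R hR
    rcases le_total R 1 with h | h
    · have := intervalIntegral.norm_integral_le_of_norm_le_const (a := 0) (b := R)
        (f := Real.sinc) (C := 1) (fun x _ => Real.abs_sinc_le_one x)
      rw [Real.norm_eq_abs, sub_zero, abs_of_nonneg hR] at this
      linarith
    · have h1 := abs_integral_sinc_sub_le (by linarith : 0 < R)
      have h2 : 2 / R ≤ 2 := div_le_self (by norm_num) h
      have h3 := Real.pi_le_four
      have h4 := Real.pi_pos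
      rw [abs_le] at h1 ⊢
      constructor <;> linarith
  rcases le_total 0 R with h | h
  · exact key R h
  · rw [← neg_neg R, integral_sinc_neg, abs_neg]
    exact key _ (by linarith)

lemma tendsto_integral_sinc_mul (x : ℝ) :
    Tendsto (fun R : ℝ => ∫ q in (0 : ℝ)..(R * x), Real.sinc q) atTop
      (𝓝 (Real.pi / 2 * Real.sign x)) := by
  rcases lt_trichotomy x 0 with h | rfl | h
  · rw [Real.sign_of_neg h]
    have : Tendsto (fun R : ℝ => R * -x) atTop atTop :=
      tendsto_id.atTop_mul_const (by linarith)
    refine ((tendsto_integral_sinc.comp this).neg.congr fun R => ?_).trans (by simp)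
    rw [Function.comp, ← integral_sinc_neg]
    simp
  · simp
  · rw [Real.sign_of_pos h, mul_one]
    exact tendsto_integral_sinc.comp (tendsto_id.atTop_mul_const h)

/-! ### The Gil-Pelaez inversion formula -/

section GilPelaez

variable (ν : Measure ℝ) [IsProbabilityMeasure ν]

lemma im_charFun_mul_exp (q T : ℝ) :
    (charFun ν q * Complex.exp (-Complex.I * q * T)).im =
      ∫ x, Real.sin (q * (x - T)) ∂ν := by
  rw [charFun_apply_real, ← integral_mul_const]
  have hint : Integrable (fun x : ℝ => Complex.exp (q * x * Complex.I) *
      Complex.exp (-Complex.I * q * T)) ν := by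
    refine Integrable.mul_const ?_ _
    refine Integrable.mono' (integrable_const (1 : ℝ)) (by fun_prop) ?_
    refine Eventually.of_forall fun x => ?_
    rw [← Complex.ofReal_mul, Complex.norm_exp_ofReal_mul_I]
  have := integral_im hint
  simp only [RCLike.im_to_complex] at this
  rw [← this]
  refine integral_congr_ae (Eventually.of_forall fun x => ?_)
  simp only
  rw [← Complex.exp_add]
  have : (q * x * Complex.I + -Complex.I * q * T : ℂ) = ((q * (x - T) : ℝ) : ℂ) * Complex.I := by
    push_cast; ring
  rw [this, Complex.exp_ofReal_mul_I_im]

lemma mul_sinc_mul {q : ℝ} (hq : q ≠ 0) (y : ℝ) :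
    y * Real.sinc (q * y) = Real.sin (q * y) * q⁻¹ := by
  rcases eq_or_ne y 0 with rfl | hy
  · simp
  · rw [Real.sinc_of_ne_zero (mul_ne_zero hq hy)]
    field_simp

lemma integral_mul_sinc_mul (R y : ℝ) :
    ∫ q in (0 : ℝ)..R, y * Real.sinc (q * y) = ∫ q in (0 : ℝ)..(R * y), Real.sinc q := by
  rw [intervalIntegral.integral_const_mul, intervalIntegral.mul_integral_comp_mul_right]
  simp

variable {ν}

/-- The dominating function is $|x-T|$; this is where the finite first moment enters the inversion.
-/
lemma integrable_prod_mul_sinc (hν : Integrable (fun x : ℝ => x) ν) (R T : ℝ) :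
    Integrable (Function.uncurry fun q x : ℝ => (x - T) * Real.sinc (q * (x - T)))
      ((volume.restrict (Set.Ioc 0 R)).prod ν) := by
  have h : Integrable (fun x : ℝ => x - T) ν := hν.sub (integrable_const T)
  refine Integrable.mono (h.comp_snd (volume.restrict (Set.Ioc 0 R))) ?_ ?_
  · refine Continuous.aestronglyMeasurable ?_
    unfold Function.uncurry
    fun_prop
  · refine Eventually.of_forall fun z => ?_
    simp only [Function.uncurry, norm_mul]
    exact mul_le_of_le_one_right (norm_nonneg _) (Real.abs_sinc_le_one _)

lemma ae_im_charFun_mul_inv (R T : ℝ) :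
    (fun q : ℝ => ∫ x, (x - T) * Real.sinc (q * (x - T)) ∂ν) =ᵐ[volume.restrict (Set.Ioc 0 R)]
      fun q : ℝ => (charFun ν q * Complex.exp (-Complex.I * q * T)).im * q⁻¹ := by
  filter_upwards [ae_restrict_mem measurableSet_Ioc] with q hq
  rw [im_charFun_mul_exp, ← integral_mul_const]
  simp_rw [mul_sinc_mul hq.1.ne']

theorem intervalIntegrable_gilPelaez (hν : Integrable (fun x : ℝ => x) ν) {R : ℝ} (hR : 0 < R)
    (T : ℝ) : IntervalIntegrable
      (fun q : ℝ => (charFun ν q * Complex.exp (-Complex.I * q * T)).im * q⁻¹) volume 0 R := by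
  rw [intervalIntegrable_iff_integrableOn_Ioc_of_le hR.le]
  exact (integrable_prod_mul_sinc hν R T).integral_prod_left.congr (ae_im_charFun_mul_inv R T)

/-- Fubini turns the truncated integral into the mean of the sine integral at $R(x-T)$; dominated
convergence gives the mean of $\frac\pi2\mathrm{sign}(x-T)$. -/
theorem tendsto_gilPelaez (hν : Integrable (fun x : ℝ => x) ν) {T : ℝ} (hT : ν {T} = 0) :
    Tendsto (fun R : ℝ => 1 / 2 - 1 / Real.pi *
      ∫ q in (0 : ℝ)..R, (charFun ν q * Complex.exp (-Complex.I * q * T)).im * q⁻¹)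
      atTop (𝓝 (ν.real (Set.Iio T))) := by
  have h1 : ∀ R : ℝ, 0 < R →
      ∫ q in (0 : ℝ)..R, (charFun ν q * Complex.exp (-Complex.I * q * T)).im * q⁻¹ =
      ∫ x, (∫ q in (0 : ℝ)..(R * (x - T)), Real.sinc q) ∂ν := by
    intro R hR
    rw [intervalIntegral.integral_of_le hR.le, ← integral_congr_ae (ae_im_charFun_mul_inv R T),
      integral_integral_swap (integrable_prod_mul_sinc hν R T)]
    simp_rw [← intervalIntegral.integral_of_le hR.le, integral_mul_sinc_mul]
  have hcont : Continuous fun y : ℝ => ∫ q in (0 : ℝ)..y, Real.sinc q :=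
    intervalIntegral.continuous_primitive
      (fun a b => Real.continuous_sinc.intervalIntegrable a b) 0
  have h2 : Tendsto (fun R : ℝ => ∫ x, (∫ q in (0 : ℝ)..(R * (x - T)), Real.sinc q) ∂ν) atTop
      (𝓝 (∫ x, Real.pi / 2 * Real.sign (x - T) ∂ν)) := by
    refine tendsto_integral_filter_of_dominated_convergence (fun _ => (4 : ℝ)) ?_ ?_
      (integrable_const _) ?_
    · refine Eventually.of_forall fun R => Continuous.aestronglyMeasurable ?_
      exact hcont.comp (by fun_prop)
    · exact Eventually.of_forall fun R => Eventually.of_forall fun x => abs_integral_sinc_le _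
    · exact Eventually.of_forall fun x => tendsto_integral_sinc_mul (x - T)
  -- Without an atom at $T$, the sign equals $1-2\cdot1_{x<T}$ almost surely; an atom would add half
  -- its mass to the limit.
  have hsign : ∫ x, Real.pi / 2 * Real.sign (x - T) ∂ν =
      Real.pi / 2 * (1 - 2 * ν.real (Set.Iio T)) := by
    rw [integral_const_mul]
    congr 1
    have : (fun x => Real.sign (x - T)) =ᵐ[ν]
        fun x => 1 - 2 * (Set.Iio T).indicator (fun _ => (1 : ℝ)) x := by
      have hne : ∀ᵐ x ∂ν, x ≠ T := by
        rw [ae_iff]; simpa using hT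
      filter_upwards [hne] with x hx
      rcases lt_or_gt_of_ne hx with h | h
      · rw [Real.sign_of_neg (by linarith), Set.indicator_of_mem (by simpa using h)]
        norm_num
      · rw [Real.sign_of_pos (by linarith), Set.indicator_of_notMem (by simpa using h.le)]
        norm_num
    rw [integral_congr_ae this, integral_sub (integrable_const _)
      (((integrable_const _).indicator measurableSet_Iio).const_mul _), integral_const_mul,
      integral_indicator_const _ measurableSet_Iio]
    simp
  rw [hsign] at h2
  have h3 := (h2.const_mul (1 / Real.pi)).const_sub (1 / 2)
  have : 1 / 2 - 1 / Real.pi * (Real.pi / 2 * (1 - 2 * ν.real (Set.Iio T))) =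
      ν.real (Set.Iio T) := by
    have := Real.pi_ne_zero
    field_simp
    ring
  rw [this] at h3
  refine h3.congr' ?_
  filter_upwards [eventually_gt_atTop 0] with R hR
  rw [h1 R hR]

end GilPelaez

/-! ### Powers of `1 - i y` -/

lemma one_sub_I_mul_mem_slitPlane (y : ℝ) : 1 - Complex.I * y ∈ Complex.slitPlane := by
  left; simp

lemma one_sub_I_mul_ne_zero (y : ℝ) : 1 - Complex.I * (y : ℂ) ≠ 0 :=
  Complex.slitPlane_ne_zero (one_sub_I_mul_mem_slitPlane y)

lemma one_le_norm_one_sub_I_mul (y : ℝ) : 1 ≤ ‖1 - Complex.I * (y : ℂ)‖ := by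
  have := Complex.abs_re_le_norm (1 - Complex.I * (y : ℂ))
  simpa using this

lemma norm_one_sub_I_mul_le (y : ℝ) : ‖1 - Complex.I * (y : ℂ)‖ ≤ 1 + |y| := by
  refine (norm_sub_le _ _).trans ?_
  simp

lemma hasDerivAt_one_sub_I_mul (y : ℝ) :
    HasDerivAt (fun y : ℝ => 1 - Complex.I * (y : ℂ)) (-Complex.I) y := by
  have := ((Complex.ofRealCLM.hasDerivAt (x := y)).const_mul Complex.I).const_sub 1
  simpa using this

lemma hasDerivAt_one_sub_I_mul_cpow (y : ℝ) (a : ℂ) :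
    HasDerivAt (fun y : ℝ => (1 - Complex.I * (y : ℂ)) ^ a)
      (a * (1 - Complex.I * y) ^ (a - 1) * (-Complex.I)) y :=
  HasDerivAt.comp (h₂ := fun z : ℂ => z ^ a) y ((Complex.hasStrictDerivAt_cpow_const
    (one_sub_I_mul_mem_slitPlane y)).hasDerivAt) (hasDerivAt_one_sub_I_mul y)

lemma norm_one_sub_I_mul_cpow_le {y M : ℝ} (hy : |y| ≤ M) (a : ℝ) :
    ‖(1 - Complex.I * (y : ℂ)) ^ (a : ℂ)‖ ≤ (1 + M) ^ |a| := by
  rw [Complex.norm_cpow_of_ne_zero (one_sub_I_mul_ne_zero y)]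
  simp only [Complex.ofReal_re, Complex.ofReal_im, mul_zero, Real.exp_zero, div_one]
  calc ‖1 - Complex.I * (y : ℂ)‖ ^ a ≤ ‖1 - Complex.I * (y : ℂ)‖ ^ |a| :=
        Real.rpow_le_rpow_of_exponent_le (one_le_norm_one_sub_I_mul y) (le_abs_self a)
    _ ≤ (1 + M) ^ |a| := Real.rpow_le_rpow (norm_nonneg _)
        ((norm_one_sub_I_mul_le y).trans (by linarith)) (abs_nonneg a)

/-! ### Mean of the characteristic function of a gamma variable over a lobe -/

/-- The mean of `(1 - i y sin² θ) ^ (-m)` over `θ`. -/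
def lobeMean (m : ℕ) (y : ℝ) : ℂ :=
  ((2 / Real.pi : ℝ) : ℂ) *
    ∫ θ in (0 : ℝ)..(Real.pi / 2), ((1 - Complex.I * ((y * Real.sin θ ^ 2 : ℝ) : ℂ)) ^ m)⁻¹

lemma norm_inv_one_sub_I_mul_pow_le (m : ℕ) (y : ℝ) :
    ‖((1 - Complex.I * (y : ℂ)) ^ m)⁻¹‖ ≤ 1 := by
  rw [norm_inv, norm_pow]
  exact inv_le_one_of_one_le₀ (one_le_pow₀ (one_le_norm_one_sub_I_mul y))

lemma continuous_inv_one_sub_I_mul_pow (m : ℕ) :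
    Continuous fun y : ℝ => ((1 - Complex.I * (y : ℂ)) ^ m)⁻¹ :=
  Continuous.inv₀ (by fun_prop) fun y => pow_ne_zero m (one_sub_I_mul_ne_zero y)

lemma hasDerivAt_inv_one_sub_I_mul_pow (m : ℕ) (y s : ℝ) :
    HasDerivAt (fun y : ℝ => ((1 - Complex.I * ((y * s : ℝ) : ℂ)) ^ m)⁻¹)
      (m * (Complex.I * s) * ((1 - Complex.I * ((y * s : ℝ) : ℂ)) ^ (m + 1))⁻¹) y := by
  have hne := one_sub_I_mul_ne_zero (y * s)
  have h1 : HasDerivAt (fun y : ℝ => 1 - Complex.I * ((y * s : ℝ) : ℂ)) (-Complex.I * s) y := by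
    have := (hasDerivAt_one_sub_I_mul (y * s)).scomp y ((hasDerivAt_id y).mul_const s)
    refine this.congr_deriv ?_
    simp
    ring
  refine ((h1.pow m).inv (pow_ne_zero m hne)).congr_deriv ?_
  cases m with
  | zero => simp
  | succ k =>
    simp only [Nat.add_sub_cancel, Pi.pow_apply]
    field_simp
    ring

lemma hasDerivAt_lobeMean (m : ℕ) (y : ℝ) :
    HasDerivAt (lobeMean m) (((2 / Real.pi : ℝ) : ℂ) *
      ∫ θ in (0 : ℝ)..(Real.pi / 2), (m * (Complex.I * ((Real.sin θ ^ 2 : ℝ) : ℂ)) *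
        ((1 - Complex.I * ((y * Real.sin θ ^ 2 : ℝ) : ℂ)) ^ (m + 1))⁻¹)) y := by
  refine HasDerivAt.const_mul _ ?_
  have hc : ∀ (k : ℕ) (x : ℝ), Continuous fun θ : ℝ =>
      ((1 - Complex.I * ((x * Real.sin θ ^ 2 : ℝ) : ℂ)) ^ k)⁻¹ := fun k x =>
    (continuous_inv_one_sub_I_mul_pow k).comp (by fun_prop)
  refine (intervalIntegral.hasDerivAt_integral_of_dominated_loc_of_deriv_le
    (μ := volume) (a := 0) (b := Real.pi / 2) (s := Set.univ) (bound := fun _ => (m : ℝ))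
    (F := fun (y θ : ℝ) => ((1 - Complex.I * ((y * Real.sin θ ^ 2 : ℝ) : ℂ)) ^ m)⁻¹)
    (F' := fun (y θ : ℝ) => (m * (Complex.I * ((Real.sin θ ^ 2 : ℝ) : ℂ)) *
        ((1 - Complex.I * ((y * Real.sin θ ^ 2 : ℝ) : ℂ)) ^ (m + 1))⁻¹))
    Filter.univ_mem ?_ ?_ ?_ ?_ ?_ ?_).2
  · exact Eventually.of_forall fun x => (hc m x).aestronglyMeasurable
  · exact (hc m y).intervalIntegrable _ _
  · refine Continuous.aestronglyMeasurable ?_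
    have := hc (m + 1) y
    fun_prop
  · refine Eventually.of_forall fun θ _ x _ => ?_
    rw [norm_mul, norm_mul, norm_mul, Complex.norm_I, one_mul, Complex.norm_natCast,
      Complex.norm_real, Real.norm_of_nonneg (sq_nonneg _)]
    calc (m : ℝ) * Real.sin θ ^ 2 * _ ≤ m * 1 * 1 := by
          gcongr
          · exact Real.sin_sq_le_one θ
          · exact norm_inv_one_sub_I_mul_pow_le _ _
      _ = m := by ring
  · simp
  · exact Eventually.of_forall fun θ _ x _ => hasDerivAt_inv_one_sub_I_mul_pow m x _

lemma intervalIntegrable_lobeMean (m : ℕ) (y a b : ℝ) :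
    IntervalIntegrable (fun θ : ℝ =>
      ((1 - Complex.I * ((y * Real.sin θ ^ 2 : ℝ) : ℂ)) ^ m)⁻¹) volume a b :=
  Continuous.intervalIntegrable ((continuous_inv_one_sub_I_mul_pow m).comp (by fun_prop)) _ _

/-- With $D=1-iy\sin^2\theta$ one has $iy\sin^2\theta=1-D$, so
$y\,\partial_yD^{-m}=m(D^{-m-1}-D^{-m})$ under the integral. Differentiation thus raises $m$. -/
lemma lobeMean_succ {m : ℕ} {y : ℝ} {d : ℂ} (hd : HasDerivAt (lobeMean m) d y) :
    (y : ℂ) * d = m * (lobeMean (m + 1) y - lobeMean m y) := by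
  rw [hd.unique (hasDerivAt_lobeMean m y)]
  unfold lobeMean
  rw [← mul_sub, ← intervalIntegral.integral_sub (intervalIntegrable_lobeMean _ _ _ _)
    (intervalIntegrable_lobeMean _ _ _ _), mul_left_comm, mul_left_comm (m : ℂ)]
  congr 1
  rw [← intervalIntegral.integral_const_mul, ← intervalIntegral.integral_const_mul]
  refine intervalIntegral.integral_congr fun θ _ => ?_
  have hne := one_sub_I_mul_ne_zero (y * Real.sin θ ^ 2)
  generalize hD : 1 - Complex.I * ((y * Real.sin θ ^ 2 : ℝ) : ℂ) = D at hne ⊢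
  have h2 : (y : ℂ) * (Complex.I * ((Real.sin θ ^ 2 : ℝ) : ℂ)) = 1 - D := by
    rw [← hD]; push_cast; ring
  have h3 : (y : ℂ) * (m * (Complex.I * ((Real.sin θ ^ 2 : ℝ) : ℂ)) * (D ^ (m + 1))⁻¹) =
      m * ((y : ℂ) * (Complex.I * ((Real.sin θ ^ 2 : ℝ) : ℂ))) * (D ^ (m + 1))⁻¹ := by ring
  rw [h3, h2]
  field_simp
  ring

/-- The function vanishes at $0$ and $\pi/2$, so its derivative has integral zero; this is the
linear relation behind `lobeMean_one_deriv`. -/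
lemma hasDerivAt_sin_mul_cos_div (y θ : ℝ) :
    HasDerivAt (fun θ : ℝ => ((Real.sin θ * Real.cos θ : ℝ) : ℂ) *
        ((1 - Complex.I * ((y * Real.sin θ ^ 2 : ℝ) : ℂ)))⁻¹)
      ((1 - 2 * ((Real.sin θ ^ 2 : ℝ) : ℂ) + Complex.I * y * ((Real.sin θ ^ 2 : ℝ) : ℂ)) *
        ((1 - Complex.I * ((y * Real.sin θ ^ 2 : ℝ) : ℂ)) ^ 2)⁻¹) θ := by
  have hne := one_sub_I_mul_ne_zero (y * Real.sin θ ^ 2)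
  have h0 : HasDerivAt (fun θ : ℝ => y * Real.sin θ ^ 2)
      (y * (2 * Real.sin θ * Real.cos θ)) θ := by
    refine (((Real.hasDerivAt_sin θ).pow 2).const_mul y).congr_deriv ?_
    simp
  have h1 : HasDerivAt (fun θ : ℝ => 1 - Complex.I * ((y * Real.sin θ ^ 2 : ℝ) : ℂ))
      ((y * (2 * Real.sin θ * Real.cos θ)) • -Complex.I) θ :=
    (hasDerivAt_one_sub_I_mul (y * Real.sin θ ^ 2)).scomp θ h0
  have h2 := ((Real.hasDerivAt_sin θ).mul (Real.hasDerivAt_cos θ)).ofReal_comp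
  refine (h2.mul (h1.inv hne)).congr_deriv ?_
  simp only [Pi.inv_apply, Pi.mul_apply]
  have hcs : ((Real.cos θ : ℝ) : ℂ) ^ 2 = 1 - ((Real.sin θ : ℝ) : ℂ) ^ 2 := by
    have := Real.cos_sq' θ
    exact_mod_cast congrArg (fun x : ℝ => (x : ℂ)) this
  field_simp
  rw [Complex.real_smul]
  push_cast at hcs ⊢
  ring_nf
  rw [hcs]
  ring_nf

lemma lobeMean_one_deriv {y : ℝ} {d : ℂ} (hd : HasDerivAt (lobeMean 1) d y) :
    (1 - Complex.I * y) * d = Complex.I / 2 * lobeMean 1 y := by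
  have hint : ∫ θ in (0 : ℝ)..(Real.pi / 2),
      ((1 - 2 * ((Real.sin θ ^ 2 : ℝ) : ℂ) + Complex.I * y * ((Real.sin θ ^ 2 : ℝ) : ℂ)) *
        ((1 - Complex.I * ((y * Real.sin θ ^ 2 : ℝ) : ℂ)) ^ 2)⁻¹) = 0 := by
    rw [intervalIntegral.integral_eq_sub_of_hasDerivAt
      (fun θ _ => hasDerivAt_sin_mul_cos_div y θ)]
    · simp
    · refine Continuous.intervalIntegrable ?_ _ _
      have : Continuous fun θ : ℝ => ((1 - Complex.I * ((y * Real.sin θ ^ 2 : ℝ) : ℂ)) ^ 2)⁻¹ :=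
        (continuous_inv_one_sub_I_mul_pow 2).comp (by fun_prop)
      fun_prop
  have h1 : Continuous fun θ : ℝ => ((1 - Complex.I * ((y * Real.sin θ ^ 2 : ℝ) : ℂ)) ^ 2)⁻¹ :=
    (continuous_inv_one_sub_I_mul_pow 2).comp (by fun_prop)
  rw [hd.unique (hasDerivAt_lobeMean 1 y)]
  unfold lobeMean
  rw [mul_left_comm, mul_left_comm (Complex.I / 2)]
  congr 1
  rw [← sub_eq_zero, ← intervalIntegral.integral_const_mul, ← intervalIntegral.integral_const_mul,
    ← intervalIntegral.integral_sub]
  · rw [← mul_zero (-Complex.I / 2), ← hint, ← intervalIntegral.integral_const_mul]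
    refine intervalIntegral.integral_congr fun θ _ => ?_
    have hne := one_sub_I_mul_ne_zero (y * Real.sin θ ^ 2)
    push_cast at hne ⊢
    field_simp
    ring
  · refine Continuous.intervalIntegrable ?_ _ _
    fun_prop
  · exact (intervalIntegrable_lobeMean 1 y _ _).const_mul _

/-- By `lobeMean_one_deriv`, multiplication by the integrating factor $(1-iy)^{1/2}$ gives a
constant, and its value at $y=0$ is $1$. -/
lemma lobeMean_one (y : ℝ) : lobeMean 1 y = (1 - Complex.I * y) ^ (-(1 / 2) : ℂ) := by
  have h : ∀ y : ℝ, HasDerivAt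
      (fun y : ℝ => lobeMean 1 y * (1 - Complex.I * (y : ℂ)) ^ (1 / 2 : ℂ)) 0 y := by
    intro y
    have hd := hasDerivAt_lobeMean 1 y
    have h1 := lobeMean_one_deriv hd
    refine (hd.mul (hasDerivAt_one_sub_I_mul_cpow y (1 / 2))).congr_deriv ?_
    rw [Complex.cpow_sub _ _ (one_sub_I_mul_ne_zero y), Complex.cpow_one]
    generalize (((2 / Real.pi : ℝ) : ℂ) * ∫ θ in (0 : ℝ)..(Real.pi / 2), _) = d at h1 ⊢
    have hne := one_sub_I_mul_ne_zero y
    field_simp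
    linear_combination 2 * (1 - Complex.I * (y : ℂ)) ^ (1 / 2 : ℂ) * h1
  have h0 := is_const_of_deriv_eq_zero (fun y => (h y).differentiableAt) (fun y => (h y).deriv) y 0
  have h1 : lobeMean 1 0 = 1 := by
    unfold lobeMean
    have := Real.pi_ne_zero
    simp
  simp only [h1] at h0
  rw [Complex.cpow_neg]
  refine eq_inv_of_mul_eq_one_left ?_
  rw [h0]
  simp

/-! ### The closed form of the lobe mean -/

lemma add_one_mul_ringChoose_add_one (a : ℝ) (l : ℕ) :
    ((l : ℝ) + 1) * Ring.choose a (l + 1) = (a - l) * Ring.choose a l := by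
  rw [Ring.choose_eq_smul, Ring.choose_eq_smul, descPochhammer_succ_right, Polynomial.smeval_mul,
    Nat.factorial_succ]
  have : (l.factorial : ℝ) ≠ 0 := Nat.cast_ne_zero.mpr l.factorial_ne_zero
  simp [Polynomial.smeval_natCast]
  field_simp

/-- The polynomial `∑ (-1/2 choose l) (n choose l) x ^ l`. -/
def lobePoly (n : ℕ) (x : ℂ) : ℂ :=
  ∑ l ∈ Finset.range (n + 1), ((Ring.choose (-1 / 2 : ℝ) l * n.choose l : ℝ) : ℂ) * x ^ l

/-- The derivative of `lobePoly`, multiplied by `x`. -/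
def lobePolyTheta (n : ℕ) (x : ℂ) : ℂ :=
  ∑ l ∈ Finset.range (n + 1), l * (((Ring.choose (-1 / 2 : ℝ) l * n.choose l : ℝ) : ℂ) * x ^ l)

/-- This is the recursion forced on $Q_n$ by putting $(1-x)^{-n-1/2}Q_n(x)$ into `lobeMean_succ`.
Coefficientwise it follows from the ratio of consecutive values of $\binom{-1/2}{l}$ and Pascal's
rule. -/
lemma lobePoly_succ (n : ℕ) (x : ℂ) :
    ((n : ℂ) + 1) * lobePoly (n + 1) x =
      (n + 1) * lobePoly n x - x / 2 * lobePoly n x + (1 - x) * lobePolyTheta n x := by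
  have e1 : ((n : ℂ) + 1) * lobePoly n x + lobePolyTheta n x =
      ∑ l ∈ Finset.range (n + 2), ((n : ℂ) + 1 + l) *
        (((Ring.choose (-1 / 2 : ℝ) l * n.choose l : ℝ) : ℂ) * x ^ l) := by
    rw [Finset.sum_range_succ, Nat.choose_succ_self]
    unfold lobePoly lobePolyTheta
    rw [Finset.mul_sum, ← Finset.sum_add_distrib]
    simp only [Nat.cast_zero, mul_zero, Complex.ofReal_zero, zero_mul, add_zero]
    exact Finset.sum_congr rfl fun l _ => by ring
  have e2 : (n + 1) * lobePoly n x - x / 2 * lobePoly n x + (1 - x) * lobePolyTheta n x =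
      (((n : ℂ) + 1) * lobePoly n x + lobePolyTheta n x) -
        ∑ l ∈ Finset.range (n + 1), ((l : ℂ) + 1 / 2) *
          (((Ring.choose (-1 / 2 : ℝ) l * n.choose l : ℝ) : ℂ) * x ^ (l + 1)) := by
    have : ∑ l ∈ Finset.range (n + 1), ((l : ℂ) + 1 / 2) *
          (((Ring.choose (-1 / 2 : ℝ) l * n.choose l : ℝ) : ℂ) * x ^ (l + 1)) =
        x * lobePolyTheta n x + x / 2 * lobePoly n x := by
      unfold lobePoly lobePolyTheta
      rw [Finset.mul_sum, Finset.mul_sum, ← Finset.sum_add_distrib]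
      exact Finset.sum_congr rfl fun l _ => by ring
    rw [this]
    ring
  rw [e2, e1]
  unfold lobePoly
  rw [Finset.sum_range_succ', Finset.sum_range_succ' _ (n + 1), mul_add, Finset.mul_sum]
  rw [add_sub_right_comm, ← Finset.sum_sub_distrib]
  congr 1
  · refine Finset.sum_congr rfl fun l _ => ?_
    have hb := add_one_mul_ringChoose_add_one (-1 / 2) l
    have hc : ((n : ℝ) - l) * n.choose l = (l + 1) * n.choose (l + 1) := by
      rcases le_or_gt l n with h | h
      · have := Nat.choose_succ_right_eq n l
        have := congrArg (fun k : ℕ => (k : ℝ)) this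
        push_cast [Nat.cast_sub h] at this
        linarith
      · rw [Nat.choose_eq_zero_of_lt h, Nat.choose_eq_zero_of_lt (by omega)]
        simp
    have key : ((n : ℝ) + 1) * (Ring.choose (-1 / 2 : ℝ) (l + 1) * (n + 1).choose (l + 1)) =
        (n + 1 + (l + 1)) * (Ring.choose (-1 / 2 : ℝ) (l + 1) * n.choose (l + 1)) -
          (l + 1 / 2) * (Ring.choose (-1 / 2 : ℝ) l * n.choose l) := by
      rw [Nat.choose_succ_succ]
      push_cast
      linear_combination Ring.choose (-1 / 2 : ℝ) (l + 1) * hc + (n.choose l : ℝ) * hb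
    have key' := congrArg (fun t : ℝ => (t : ℂ) * x ^ (l + 1)) key
    push_cast at key' ⊢
    linear_combination key'
  · simp

lemma hasDerivAt_lobePoly (n : ℕ) (y : ℝ) :
    ∃ d : ℂ, HasDerivAt (fun y : ℝ => lobePoly n (Complex.I * y)) d y ∧
      y * d = lobePolyTheta n (Complex.I * y) := by
  refine ⟨∑ l ∈ Finset.range (n + 1), ((Ring.choose (-1 / 2 : ℝ) l * n.choose l : ℝ) : ℂ) *
    (l * (Complex.I * y) ^ (l - 1) * Complex.I), ?_, ?_⟩
  · unfold lobePoly
    refine HasDerivAt.fun_sum fun l _ => HasDerivAt.const_mul _ ?_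
    have h1 : HasDerivAt (fun y : ℝ => Complex.I * (y : ℂ)) Complex.I y := by
      simpa using (Complex.ofRealCLM.hasDerivAt (x := y)).const_mul Complex.I
    exact h1.pow l
  · unfold lobePolyTheta
    rw [Finset.mul_sum]
    refine Finset.sum_congr rfl fun l _ => ?_
    cases l with
    | zero => simp
    | succ k =>
      rw [Nat.add_sub_cancel, pow_succ]
      ring

/-- Induction on $n$: differentiating the formula for $n$ and applying `lobeMean_succ` reproduces
the polynomial recursion `lobePoly_succ`, with $y\,d/dy$ acting as $x\,d/dx$ for $x=iy$. -/
theorem lobeMean_eq (n : ℕ) (y : ℝ) :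
    lobeMean (n + 1) y =
      (1 - Complex.I * y) ^ (-(n : ℂ) - 1 / 2) * lobePoly n (Complex.I * y) := by
  induction n generalizing y with
  | zero =>
    rw [zero_add, lobeMean_one]
    simp [lobePoly]
  | succ n ih =>
    obtain ⟨d, hd, hd'⟩ := hasDerivAt_lobePoly n y
    have h1 := (hasDerivAt_one_sub_I_mul_cpow y (-(n : ℂ) - 1 / 2)).mul hd
    have h2 := lobeMean_succ (h1.congr_of_eventuallyEq
      (Eventually.of_forall fun y => ih y))
    rw [ih y] at h2
    have h3 := lobePoly_succ n (Complex.I * y)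
    have hne := one_sub_I_mul_ne_zero y
    have e1 : (1 - Complex.I * (y : ℂ)) ^ (-(n : ℂ) - 1 / 2) =
        (1 - Complex.I * (y : ℂ)) ^ (-((n + 1 : ℕ) : ℂ) - 1 / 2) * (1 - Complex.I * y) := by
      have := Complex.cpow_add (-((n + 1 : ℕ) : ℂ) - 1 / 2) 1 hne
      rw [Complex.cpow_one] at this
      rw [← this]
      congr 1; push_cast; ring
    have e2 : (-(n : ℂ) - 1 / 2 - 1) = -((n + 1 : ℕ) : ℂ) - 1 / 2 := by push_cast; ring
    rw [e2, e1] at h2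
    have hn : ((n + 1 : ℕ) : ℂ) ≠ 0 := Nat.cast_ne_zero.mpr n.succ_ne_zero
    refine mul_left_cancel₀ hn ?_
    generalize (1 - Complex.I * (y : ℂ)) ^ (-((n + 1 : ℕ) : ℂ) - 1 / 2) = P at h2 ⊢
    push_cast at h2 ⊢
    rw [mul_left_comm, h3, ← hd']
    linear_combination -h2

/-! ### Euler's integral for `₂F₁(1, b; B + 1; i u)` -/

/-- Euler's integral `∫₀¹ (1 - t) ^ (B - 1) (1 - i t u) ^ (-b) dt`. -/
def eulerIntegral (B b u : ℝ) : ℂ :=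
  ∫ t in (0 : ℝ)..1, (((1 - t) ^ (B - 1) : ℝ) : ℂ) *
    (1 - Complex.I * ((t * u : ℝ) : ℂ)) ^ ((-b : ℝ) : ℂ)

lemma intervalIntegrable_one_sub_rpow {B : ℝ} (hB : 0 < B) :
    IntervalIntegrable (fun t : ℝ => (1 - t) ^ (B - 1)) volume 0 1 := by
  have := (intervalIntegral.intervalIntegrable_rpow' (a := 0) (b := 1)
    (by linarith : -1 < B - 1)).comp_sub_left 1
  simpa using this.symm

lemma continuous_one_sub_I_mul_cpow (u : ℝ) (a : ℂ) :
    Continuous fun t : ℝ => (1 - Complex.I * ((t * u : ℝ) : ℂ)) ^ a := by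
  refine Continuous.cpow (by fun_prop) continuous_const fun t => ?_
  exact one_sub_I_mul_mem_slitPlane _

lemma intervalIntegrable_eulerIntegral {B : ℝ} (hB : 0 < B) {g : ℝ → ℂ} (hg : Continuous g) :
    IntervalIntegrable (fun t : ℝ => (((1 - t) ^ (B - 1) : ℝ) : ℂ) * g t) volume 0 1 :=
  IntervalIntegrable.mul_continuousOn (f := fun t : ℝ => (((1 - t) ^ (B - 1) : ℝ) : ℂ))
    ⟨(intervalIntegrable_one_sub_rpow hB).1.ofReal, (intervalIntegrable_one_sub_rpow hB).2.ofReal⟩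
    hg.continuousOn

lemma hasDerivAt_one_sub_I_mul_mul_cpow (t u b : ℝ) :
    HasDerivAt (fun u : ℝ => (1 - Complex.I * ((t * u : ℝ) : ℂ)) ^ ((-b : ℝ) : ℂ))
      (b * (Complex.I * t) * (1 - Complex.I * ((t * u : ℝ) : ℂ)) ^ ((-b - 1 : ℝ) : ℂ)) u := by
  have := (hasDerivAt_one_sub_I_mul_cpow (t * u) ((-b : ℝ) : ℂ)).scomp u
    ((hasDerivAt_id u).const_mul t)
  refine this.congr_deriv ?_
  rw [Complex.real_smul]
  push_cast
  ring

lemma hasDerivAt_eulerIntegral {B : ℝ} (hB : 0 < B) (b u : ℝ) :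
    HasDerivAt (eulerIntegral B b)
      (∫ t in (0 : ℝ)..1, (((1 - t) ^ (B - 1) : ℝ) : ℂ) *
        (b * (Complex.I * t) * (1 - Complex.I * ((t * u : ℝ) : ℂ)) ^ ((-b - 1 : ℝ) : ℂ))) u := by
  have hm : Measurable fun t : ℝ => (((1 - t) ^ (B - 1) : ℝ) : ℂ) := by fun_prop
  have hcd : Continuous fun t : ℝ =>
      (b * (Complex.I * t) * (1 - Complex.I * ((t * u : ℝ) : ℂ)) ^ ((-b - 1 : ℝ) : ℂ)) :=
    Continuous.mul (by fun_prop) (continuous_one_sub_I_mul_cpow u _)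
  refine (intervalIntegral.hasDerivAt_integral_of_dominated_loc_of_deriv_le
    (μ := volume) (a := 0) (b := 1) (s := Metric.ball u 1)
    (bound := fun t => (1 - t) ^ (B - 1) * (|b| * (1 + (|u| + 1)) ^ |-b - 1|))
    (F := fun (u t : ℝ) => (((1 - t) ^ (B - 1) : ℝ) : ℂ) *
      (1 - Complex.I * ((t * u : ℝ) : ℂ)) ^ ((-b : ℝ) : ℂ))
    (F' := fun (u t : ℝ) => (((1 - t) ^ (B - 1) : ℝ) : ℂ) *
        (b * (Complex.I * t) * (1 - Complex.I * ((t * u : ℝ) : ℂ)) ^ ((-b - 1 : ℝ) : ℂ)))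
    (Metric.ball_mem_nhds _ one_pos) ?_ ?_ ?_ ?_ ?_ ?_).2
  · exact Eventually.of_forall fun x => hm.aestronglyMeasurable.mul
      (continuous_one_sub_I_mul_cpow x _).aestronglyMeasurable
  · exact intervalIntegrable_eulerIntegral hB (continuous_one_sub_I_mul_cpow u _)
  · exact hm.aestronglyMeasurable.mul hcd.aestronglyMeasurable
  -- Since $|1-itx|\ge1$, its powers are bounded for $x$ in the unit ball around $u$, whatever the
  -- sign of the exponent. The endpoint singularity $(1-t)^{B-1}$ is integrable because $B>0$.
  · refine Eventually.of_forall fun t ht x hx => ?_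
    rw [Set.uIoc_of_le zero_le_one] at ht
    have h1 : 0 ≤ 1 - t := by linarith [ht.2]
    have hx' : |x| ≤ |u| + 1 := by
      have : |x - u| < 1 := by simpa [Real.dist_eq] using hx
      have := abs_add_le (x - u) u
      rw [sub_add_cancel] at this
      linarith
    have h2 : |t * x| ≤ |u| + 1 := by
      rw [abs_mul, abs_of_pos ht.1]
      exact (mul_le_of_le_one_left (abs_nonneg _) ht.2).trans hx'
    have h3 := norm_one_sub_I_mul_cpow_le h2 (-b - 1)
    rw [norm_mul, norm_mul, norm_mul, norm_mul, Complex.norm_real, Complex.norm_real,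
      Complex.norm_real, Complex.norm_I, one_mul, Real.norm_of_nonneg (Real.rpow_nonneg h1 _),
      Real.norm_of_nonneg ht.1.le, Real.norm_eq_abs]
    refine mul_le_mul_of_nonneg_left ?_ (Real.rpow_nonneg h1 _)
    refine mul_le_mul ?_ h3 (norm_nonneg _) (abs_nonneg _)
    exact mul_le_of_le_one_right (abs_nonneg _) ht.2
  · exact (intervalIntegrable_one_sub_rpow hB).mul_const _
  · exact Eventually.of_forall fun t _ x _ =>
      (hasDerivAt_one_sub_I_mul_mul_cpow t x b).const_mul _

/-- The integrand is the $t$-derivative of $(1-t)^B(1-itu)^{-b}$, which is $1$ at $t=0$ and $0$ at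
$t=1$. This supplies the inhomogeneous term of `eulerIntegral_ode`. -/
lemma integral_deriv_one_sub_rpow_mul_cpow {B : ℝ} (hB : 0 < B) (b u : ℝ) :
    ∫ t in (0 : ℝ)..1, (((1 - t) ^ (B - 1) : ℝ) : ℂ) *
      ((1 - t) * (b * (Complex.I * u) * (1 - Complex.I * ((t * u : ℝ) : ℂ)) ^ ((-b - 1 : ℝ) : ℂ))
        - B * (1 - Complex.I * ((t * u : ℝ) : ℂ)) ^ ((-b : ℝ) : ℂ)) = -1 := by
  rw [intervalIntegral.integral_eq_sub_of_hasDerivAt_of_le zero_le_one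
    (f := fun t : ℝ => (((1 - t) ^ B : ℝ) : ℂ) *
      (1 - Complex.I * ((t * u : ℝ) : ℂ)) ^ ((-b : ℝ) : ℂ))]
  · simp [Real.zero_rpow hB.ne']
  · refine ContinuousOn.mul (Continuous.continuousOn ?_)
      (continuous_one_sub_I_mul_cpow u _).continuousOn
    exact Complex.continuous_ofReal.comp
      ((continuous_const.sub continuous_id).rpow_const fun _ => Or.inr hB.le)
  · intro t ht
    have h1 : 0 < 1 - t := by linarith [ht.2]
    have hd1 : HasDerivAt (fun t : ℝ => (1 - t) ^ B) (-1 * B * (1 - t) ^ (B - 1)) t :=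
      ((hasDerivAt_id t).const_sub 1).rpow_const (Or.inl h1.ne')
    have hd2 := hasDerivAt_one_sub_I_mul_mul_cpow u t b
    simp_rw [mul_comm u] at hd2
    refine (hd1.ofReal_comp.mul hd2).congr_deriv ?_
    have : (1 - t) ^ B = (1 - t) ^ (B - 1) * (1 - t) := by
      rw [← Real.rpow_add_one h1.ne', sub_add_cancel]
    rw [this]
    push_cast
    ring
  · refine intervalIntegrable_eulerIntegral hB ?_
    have h1 := continuous_one_sub_I_mul_cpow u ((-b - 1 : ℝ) : ℂ)
    have h2 := continuous_one_sub_I_mul_cpow u ((-b : ℝ) : ℂ)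
    fun_prop

/-- The first-order differential equation of `₂F₁(1, b; B + 1; w)` along `w = i u`. -/
lemma eulerIntegral_ode {B : ℝ} (hB : 0 < B) {b u : ℝ} {d : ℂ}
    (hd : HasDerivAt (eulerIntegral B b) d u) :
    (1 - Complex.I * u) * (u * d) =
      1 - B * eulerIntegral B b u + b * (Complex.I * u) * eulerIntegral B b u := by
  rw [hd.unique (hasDerivAt_eulerIntegral hB b u)]
  have h1 := continuous_one_sub_I_mul_cpow u ((-b - 1 : ℝ) : ℂ)
  have h2 := continuous_one_sub_I_mul_cpow u ((-b : ℝ) : ℂ)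
  have hi1 := intervalIntegrable_eulerIntegral hB (g := fun t : ℝ => b * (Complex.I * t) *
    (1 - Complex.I * ((t * u : ℝ) : ℂ)) ^ ((-b - 1 : ℝ) : ℂ)) (by fun_prop)
  have hi2 := intervalIntegrable_eulerIntegral hB h2
  have key := integral_deriv_one_sub_rpow_mul_cpow hB b u
  have e : ∀ x : ℂ, 1 - B * x + b * (Complex.I * u) * x = 1 + (b * (Complex.I * u) - B) * x :=
    fun x => by ring
  rw [e, ← mul_assoc, ← sub_eq_iff_eq_add]
  unfold eulerIntegral
  rw [← intervalIntegral.integral_const_mul, ← intervalIntegral.integral_const_mul,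
    ← intervalIntegral.integral_sub (hi1.const_mul _) (hi2.const_mul _), ← neg_inj, ← key,
    ← intervalIntegral.integral_neg]
  refine intervalIntegral.integral_congr fun t _ => ?_
  have hne := one_sub_I_mul_ne_zero (t * u)
  have h3 : (1 - Complex.I * ((t * u : ℝ) : ℂ)) ^ ((-b : ℝ) : ℂ) =
      (1 - Complex.I * ((t * u : ℝ) : ℂ)) ^ ((-b - 1 : ℝ) : ℂ) *
        (1 - Complex.I * ((t * u : ℝ) : ℂ)) := by
    have := Complex.cpow_add ((-b - 1 : ℝ) : ℂ) 1 hne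
    rw [Complex.cpow_one] at this
    rw [← this]
    congr 1; push_cast; ring
  simp only [h3]
  push_cast
  ring

lemma gauss2F1_one {B : ℝ} (hB : 0 < B) (b u : ℝ) :
    gauss2F1 1 b (B + 1) (Complex.I * u) = B * eulerIntegral B b u := by
  unfold gauss2F1 eulerIntegral
  have h1 : Real.Gamma (B + 1) / (Real.Gamma 1 * Real.Gamma (B + 1 - 1)) = B := by
    have := (Real.Gamma_pos_of_pos hB).ne'
    rw [Real.Gamma_add_one hB.ne', Real.Gamma_one, add_sub_cancel_right]
    field_simp
  rw [h1]
  congr 1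
  refine intervalIntegral.integral_congr fun t _ => ?_
  have e : (1 : ℂ) - t * (Complex.I * u) = 1 - Complex.I * ((t * u : ℝ) : ℂ) := by
    push_cast; ring
  simp only [e, sub_self, Real.rpow_zero, one_mul, add_sub_cancel_right]
  push_cast
  rfl

/-- Derivative of the primitive in the closed form of the characteristic function. -/
lemma hasDerivAt_primitive {α z B b r : ℝ} {m l : ℕ} (hα : 0 < α) (hz : 0 < z) (hB : 0 < B)
    (hBeq : B = 2 / α + m - l - 1 / 2) (hb : b = 1 - l + 2 / α) {Y : ℝ → ℝ} (hY0 : Y r ≠ 0)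
    (hY : HasDerivAt Y (-α * r * Y r / (r ^ 2 + z ^ 2)) r) :
    HasDerivAt (fun r : ℝ => ((r ^ 2 + z ^ 2 : ℝ) : ℂ) * eulerIntegral B b (-(Y r)⁻¹) *
        (Complex.I * (Y r : ℂ)) ^ ((l : ℤ) - 1) *
        (1 - Complex.I * (Y r : ℂ)) ^ (3 / 2 - (m : ℂ)))
      (-α * r * (Complex.I * (Y r : ℂ)) ^ l *
        (1 - Complex.I * (Y r : ℂ)) ^ (1 / 2 - (m : ℂ))) r := by
  have hs : r ^ 2 + z ^ 2 ≠ 0 := by positivity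
  have hIY : Complex.I * (Y r : ℂ) ≠ 0 :=
    mul_ne_zero Complex.I_ne_zero (Complex.ofReal_ne_zero.mpr hY0)
  have hd1 : HasDerivAt (fun r : ℝ => ((r ^ 2 + z ^ 2 : ℝ) : ℂ)) ((2 * r : ℝ) : ℂ) r := by
    refine HasDerivAt.ofReal_comp ?_
    refine (((hasDerivAt_id r).pow 2).add_const (z ^ 2)).congr_deriv ?_
    simp
  have hE := hasDerivAt_eulerIntegral hB b (-(Y r)⁻¹)
  have hode := eulerIntegral_ode hB hE
  generalize (∫ t in (0 : ℝ)..1, (((1 - t) ^ (B - 1) : ℝ) : ℂ) *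
        (b * (Complex.I * t) * (1 - Complex.I * ((t * -(Y r)⁻¹ : ℝ) : ℂ)) ^
          ((-b - 1 : ℝ) : ℂ))) = d at hE hode
  have hd2 : HasDerivAt (fun r : ℝ => eulerIntegral B b (-(Y r)⁻¹)) _ r :=
    HasDerivAt.scomp (g₁ := eulerIntegral B b) (h := fun r => -(Y r)⁻¹) r hE (hY.inv hY0).neg
  have hd3 : HasDerivAt (fun r : ℝ => (Complex.I * (Y r : ℂ)) ^ ((l : ℤ) - 1)) _ r :=
    HasDerivAt.comp (h₂ := fun x : ℂ => x ^ ((l : ℤ) - 1)) r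
      (hasDerivAt_zpow ((l : ℤ) - 1) _ (Or.inl hIY)) (hY.ofReal_comp.const_mul Complex.I)
  have hd4 : HasDerivAt (fun r : ℝ => (1 - Complex.I * (Y r : ℂ)) ^ (3 / 2 - (m : ℂ))) _ r :=
    (hasDerivAt_one_sub_I_mul_cpow (Y r) (3 / 2 - (m : ℂ))).scomp r hY
  refine (((hd1.mul hd2).mul hd3).mul hd4).congr_deriv ?_
  have hne := one_sub_I_mul_ne_zero (Y r)
  have e1 : (1 - Complex.I * (Y r : ℂ)) ^ (3 / 2 - (m : ℂ)) =
      (1 - Complex.I * (Y r : ℂ)) ^ (1 / 2 - (m : ℂ)) * (1 - Complex.I * (Y r : ℂ)) := by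
    have := Complex.cpow_add (1 / 2 - (m : ℂ)) 1 hne
    rw [Complex.cpow_one] at this
    rw [← this]
    congr 1; ring
  have e2 : (3 / 2 - (m : ℂ) - 1) = 1 / 2 - (m : ℂ) := by ring
  have e3 : (Complex.I * (Y r : ℂ)) ^ ((l : ℤ) - 1) =
      (Complex.I * (Y r : ℂ)) ^ ((l : ℤ) - 1 - 1) * (Complex.I * (Y r : ℂ)) := by
    rw [← zpow_add_one₀ hIY, sub_add_cancel]
  have e4 : (Complex.I * (Y r : ℂ)) ^ l =
      (Complex.I * (Y r : ℂ)) ^ ((l : ℤ) - 1 - 1) * (Complex.I * (Y r : ℂ)) ^ 2 := by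
    rw [← zpow_natCast, ← zpow_natCast, ← zpow_add₀ hIY]
    congr 1; push_cast; ring
  simp only [Pi.mul_apply, e2]
  rw [e1, e4, e3]
  generalize (1 - Complex.I * (Y r : ℂ)) ^ (1 / 2 - (m : ℂ)) = P
  generalize (Complex.I * (Y r : ℂ)) ^ ((l : ℤ) - 1 - 1) = Z
  generalize eulerIntegral B b (-(Y r)⁻¹) = E at hode ⊢
  have hα' : (α : ℂ) ≠ 0 := Complex.ofReal_ne_zero.mpr hα.ne'
  have hY0' : (Y r : ℂ) ≠ 0 := Complex.ofReal_ne_zero.mpr hY0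
  have hs' : (r : ℂ) ^ 2 + (z : ℂ) ^ 2 ≠ 0 := by exact_mod_cast hs
  -- The values of $B$ and $b$ are exactly those for which the differential equation at $u=-1/Y$
  -- eliminates both the Euler integral and its derivative, leaving the elementary integrand.
  rw [hBeq, hb] at hode
  simp only [Complex.real_smul]
  push_cast at hode ⊢
  field_simp at hode ⊢
  linear_combination (-Complex.I * r * Z * P) * hode +
    r * Z * P * (2 * Y r * E * (α * (1 - l) + 2) - 2 * α * d) * Complex.I_sq


/-! ### The closed form as an integral over the distance -/

namespace NetworkParams

variable {p : NetworkParams}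

lemma Admissible.κ_pos (hp : p.Admissible) : 0 < p.κ := by
  have := hp.f_pos
  have := Real.pi_pos
  unfold κ lightSpeed
  positivity

lemma Admissible.Sbar_pos (hp : p.Admissible) (r : ℝ) : 0 < p.Sbar r := by
  have h1 := hp.κ_pos
  have h2 := hp.Pt_pos
  have h3 := hp.z_pos
  unfold Sbar pathLoss
  positivity

lemma Admissible.hasDerivAt_Sbar (hp : p.Admissible) (r : ℝ) :
    HasDerivAt p.Sbar (-p.α * r * p.Sbar r / (r ^ 2 + p.z ^ 2)) r := by
  have h3 := hp.z_pos
  have hs : 0 < r ^ 2 + p.z ^ 2 := by positivity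
  have h1 : HasDerivAt (fun r : ℝ => r ^ 2 + p.z ^ 2) (2 * r) r := by
    refine (((hasDerivAt_id r).pow 2).add_const (p.z ^ 2)).congr_deriv ?_
    simp
  have h2 := h1.rpow_const (p := -p.α / 2) (Or.inl hs.ne')
  have h4 := (((h2.const_mul p.κ⁻¹).const_mul p.Pt).mul_const p.κ).div_const (4 * Real.pi)
  refine h4.congr_deriv ?_
  unfold Sbar pathLoss
  rw [Real.rpow_sub_one hs.ne']
  field_simp

/-- The real number `q χ_k S̄(r) / m`, so that `cfArg` is `i` times it. -/
def cfArgIm (p : NetworkParams) (k : ℕ) (q r : ℝ) : ℝ := q * lobePeak p.N k * p.Sbar r / p.m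

lemma cfArg_eq (k : ℕ) (q r : ℝ) : p.cfArg k q r = Complex.I * (p.cfArgIm k q r : ℂ) := rfl

lemma Admissible.hasDerivAt_cfArgIm (hp : p.Admissible) (k : ℕ) (q r : ℝ) :
    HasDerivAt (p.cfArgIm k q) (-p.α * r * p.cfArgIm k q r / (r ^ 2 + p.z ^ 2)) r := by
  refine (((hp.hasDerivAt_Sbar r).const_mul (q * lobePeak p.N k)).div_const
    (p.m : ℝ)).congr_deriv ?_
  unfold cfArgIm
  ring

lemma Admissible.continuous_cfArgIm (hp : p.Admissible) (k : ℕ) (q : ℝ) :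
    Continuous (p.cfArgIm k q) :=
  continuous_iff_continuousAt.mpr fun r => (hp.hasDerivAt_cfArgIm k q r).continuousAt

lemma Admissible.cfArgIm_ne_zero (hp : p.Admissible) {k : ℕ} (hk : lobePeak p.N k ≠ 0) {q : ℝ}
    (hq : q ≠ 0) (r : ℝ) : p.cfArgIm k q r ≠ 0 := by
  have h1 : (p.m : ℝ) ≠ 0 := by have := hp.m_pos; positivity
  have h2 := (hp.Sbar_pos r).ne'
  unfold cfArgIm
  positivity

lemma Admissible.hasDerivAt_cfTerm (hp : p.Admissible) {k l : ℕ} (hk : lobePeak p.N k ≠ 0)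
    (hl : l < p.m) {q : ℝ} (hq : q ≠ 0) (r : ℝ) :
    HasDerivAt (p.cfTerm k l q)
      (-(1 / 2) * r * ((1 - Complex.I * (p.cfArgIm k q r : ℂ)) ^ (1 / 2 - (p.m : ℂ)) *
        (((Ring.choose (-1 / 2 : ℝ) l * (p.m - 1).choose l : ℝ) : ℂ) *
          (Complex.I * (p.cfArgIm k q r : ℂ)) ^ l))) r := by
  have hα : 0 < p.α := by linarith [hp.α_gt]
  have hl' : (l : ℝ) + 1 ≤ p.m := by exact_mod_cast hl
  have h2α : 0 < 2 / p.α := by positivity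
  set B : ℝ := 2 / p.α + p.m - l - 1 / 2 with hBeq
  set b : ℝ := 1 - l + 2 / p.α with hb
  have hB : 0 < B := by rw [hBeq]; linarith
  have h := ((hasDerivAt_primitive hα hp.z_pos hB hBeq hb (hp.cfArgIm_ne_zero hk hq r)
    (hp.hasDerivAt_cfArgIm k q r)).const_mul
      (((Ring.choose (-1 / 2 : ℝ) l * (p.m - 1).choose l : ℝ) : ℂ) / (2 * p.α)))
  have hα' : (p.α : ℂ) ≠ 0 := Complex.ofReal_ne_zero.mpr hα.ne'
  refine (h.congr_of_eventuallyEq (Eventually.of_forall fun x => ?_)).congr_deriv ?_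
  · have hIY : Complex.I * (p.cfArgIm k q x : ℂ) ≠ 0 := mul_ne_zero Complex.I_ne_zero
      (Complex.ofReal_ne_zero.mpr (hp.cfArgIm_ne_zero hk hq x))
    have hne := one_sub_I_mul_ne_zero (p.cfArgIm k q x)
    have e1 : 1 / (Complex.I * (p.cfArgIm k q x : ℂ)) =
        Complex.I * ((-(p.cfArgIm k q x)⁻¹ : ℝ) : ℂ) := by
      rw [div_eq_iff hIY]
      have := Complex.ofReal_ne_zero.mpr (hp.cfArgIm_ne_zero hk hq x)
      push_cast
      field_simp
      simp
    have e2 : (1 / 2 - l + p.m + 2 / p.α : ℝ) = B + 1 := by rw [hBeq]; ring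
    -- The denominator of the closed form contains the same $B$ that Euler's formula puts in front
    -- of the integral, so the two cancel and only $1/(2\alpha)$ survives.
    have e3 : ((4 + p.α * (2 * p.m - 2 * l - 1) : ℝ) : ℂ) = 2 * p.α * B := by
      rw [hBeq]; push_cast; field_simp; ring
    have e4 : (1 - Complex.I * (p.cfArgIm k q x : ℂ)) ^ ((p.m : ℂ) - 3 / 2) =
        ((1 - Complex.I * (p.cfArgIm k q x : ℂ)) ^ (3 / 2 - (p.m : ℂ)))⁻¹ := by
      rw [← Complex.cpow_neg, neg_sub]
    have e5 : (Complex.I * (p.cfArgIm k q x : ℂ)) ^ (1 - (l : ℤ)) =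
        ((Complex.I * (p.cfArgIm k q x : ℂ)) ^ ((l : ℤ) - 1))⁻¹ := by
      rw [← zpow_neg, neg_sub]
    have hB' : (B : ℂ) ≠ 0 := Complex.ofReal_ne_zero.mpr hB.ne'
    unfold cfTerm
    beta_reduce
    rw [cfArg_eq, e1, e2, ← hb, gauss2F1_one hB, e3, e4, e5]
    generalize eulerIntegral B b _ = E
    generalize (1 - Complex.I * (p.cfArgIm k q x : ℂ)) ^ (3 / 2 - (p.m : ℂ)) = P
    push_cast
    field_simp
  · field_simp

lemma continuous_lobeMean (m : ℕ) : Continuous (lobeMean m) :=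
  continuous_iff_continuousAt.mpr fun y => (hasDerivAt_lobeMean m y).continuousAt

/-- Fundamental theorem of calculus: the derivatives of the terms add up over $l$ to the polynomial
form of the lobe mean. The conditions $q\ne0$ and $\chi_k\ne0$ keep $1/c_k$ meaningful. -/
lemma Admissible.sum_cfTerm_sub (hp : p.Admissible) {k : ℕ} (hk : lobePeak p.N k ≠ 0)
    {q : ℝ} (hq : q ≠ 0) (a b : ℝ) :
    ∑ l ∈ Finset.range p.m, (p.cfTerm k l q b - p.cfTerm k l q a) =
      -(1 / 2) * ∫ r in a..b, (r : ℂ) * lobeMean p.m (p.cfArgIm k q r) := by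
  obtain ⟨n, hn⟩ : ∃ n, p.m = n + 1 := ⟨p.m - 1, by have := hp.m_pos; omega⟩
  have hd : ∀ r : ℝ, HasDerivAt (fun r => ∑ l ∈ Finset.range p.m, p.cfTerm k l q r)
      (-(1 / 2) * (r * lobeMean p.m (p.cfArgIm k q r))) r := by
    intro r
    refine (HasDerivAt.fun_sum fun l hl =>
      hp.hasDerivAt_cfTerm hk (Finset.mem_range.mp hl) hq r).congr_deriv ?_
    rw [← Finset.mul_sum, ← Finset.mul_sum, mul_assoc]
    congr 2
    rw [hn, lobeMean_eq, lobePoly]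
    congr 2
    push_cast
    ring
  have hc : Continuous fun r : ℝ => (r : ℂ) * lobeMean p.m (p.cfArgIm k q r) :=
    Complex.continuous_ofReal.mul ((continuous_lobeMean _).comp (hp.continuous_cfArgIm k q))
  rw [Finset.sum_sub_distrib, ← intervalIntegral.integral_const_mul,
    intervalIntegral.integral_eq_sub_of_hasDerivAt (fun r _ => hd r)
      ((continuous_const.mul hc).intervalIntegrable _ _)]

end NetworkParams

/-! ### The probability generating functional of a Poisson process -/

/-- Used for sums and products whose number of terms is random. -/
lemma measurable_comp_of_countable {Ω β : Type*} [MeasurableSpace Ω] [MeasurableSpace β]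
    {n : Ω → ℕ} (hn : Measurable n) {F : ℕ → Ω → β} (hF : ∀ k, Measurable (F k)) :
    Measurable fun ω => F (n ω) ω := by
  have : Measurable fun x : ℕ × Ω => F x.1 x.2 := measurable_from_prod_countable_right hF
  exact this.comp (hn.prodMk measurable_id)

lemma measurable_pointCount {Ω E : Type*} [MeasurableSpace Ω] [MeasurableSpace E] {n : Ω → ℕ}
    {X : ℕ → Ω → E} (hn : Measurable n) (hX : ∀ i, Measurable (X i)) {B : Set E}
    (hB : MeasurableSet B) : Measurable (pointCount n X B) := by
  classical
  have h : pointCount n X B = fun ω => ∑ i ∈ Finset.range (n ω), (X i ⁻¹' B).indicator 1 ω := by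
    funext ω
    unfold pointCount
    rw [Finset.card_filter]
    refine Finset.sum_congr rfl fun i _ => ?_
    simp only [Set.indicator_apply, Set.mem_preimage, Pi.one_apply]
  rw [h]
  exact measurable_comp_of_countable (F := fun k ω => ∑ i ∈ Finset.range k,
    (X i ⁻¹' B).indicator 1 ω) hn fun k =>
    Finset.measurable_fun_sum _ fun i _ => measurable_one.indicator (hX i hB)

lemma pointSigma_le {Ω E : Type*} [mΩ : MeasurableSpace Ω] [MeasurableSpace E] {n : Ω → ℕ}
    {X : ℕ → Ω → E} (hn : Measurable n) (hX : ∀ i, Measurable (X i)) : pointSigma n X ≤ mΩ := by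
  refine iSup₂_le fun B hB => ?_
  rw [← measurable_iff_comap_le]
  exact measurable_pointCount hn hX hB

lemma integral_pow_poissonMeasure (r : NNReal) (v : ℂ) :
    ∫ k, v ^ k ∂(poissonMeasure r) = Complex.exp (r * (v - 1)) := by
  rw [integral_poissonMeasure]
  calc ∑' k : ℕ, (Real.exp (-r) * r ^ k / k.factorial : ℝ) • v ^ k
      = ∑' k : ℕ, (Real.exp (-r) : ℂ) * ((r * v) ^ k / k.factorial) := by
        congr with k
        rw [Complex.real_smul]
        push_cast
        ring
    _ = Complex.exp (r * (v - 1)) := by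
        rw [tsum_mul_left, (NormedSpace.expSeries_div_hasSum_exp ((r : ℂ) * v)).tsum_eq,
          ← Complex.exp_eq_exp_ℂ, Complex.ofReal_exp, ← Complex.exp_add]
        push_cast
        ring_nf

lemma norm_prod_le_one {ι : Type*} (s : Finset ι) {f : ι → ℂ} (hf : ∀ i, ‖f i‖ ≤ 1) :
    ‖∏ i ∈ s, f i‖ ≤ 1 := by
  rw [norm_prod]
  exact Finset.prod_le_one (fun _ _ => norm_nonneg _) fun i _ => hf i

namespace IsPoissonProcess

variable {Ω E : Type*} [MeasurableSpace Ω] [MeasurableSpace E] {μ : Measure Ω}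
  {Λ : Measure E} [IsFiniteMeasure Λ] {n : Ω → ℕ} {X : ℕ → Ω → E}

/-- The number of points has finite mean. -/
lemma integrable_card (h : IsPoissonProcess μ Λ n X) :
    Integrable (fun ω => (n ω : ℝ)) μ := by
  have hn : n = pointCount n X Set.univ := by
    funext ω
    simp [pointCount]
  have hlaw := h.count_law Set.univ MeasurableSet.univ
  have hsum : Integrable (fun k : ℕ => (k : ℝ)) (poissonMeasure (Λ Set.univ).toNNReal) := by
    rw [integrable_poissonMeasure_iff]
    generalize (Λ Set.univ).toNNReal = r
    rw [← summable_nat_add_iff 1]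
    refine ((Real.summable_pow_div_factorial r).mul_left (Real.exp (-r) * r)).congr fun k => ?_
    rw [Nat.factorial_succ, Real.norm_natCast]
    have := Nat.factorial_ne_zero k
    push_cast
    field_simp
    ring
  rw [← hlaw.map_eq] at hsum
  have := hsum.comp_aemeasurable hlaw.aemeasurable
  rw [← hn] at this
  exact this

/-- Grouping the points by the value $v$ of $\varphi$ turns the product into $\prod_v v^{N_v}$, with
$N_v$ the counts in the disjoint level sets. These are independent Poisson variables, and each has
generating function $e^{\Lambda_v(v-1)}$. -/
lemma integral_prod_simpleFunc (h : IsPoissonProcess μ Λ n X) (φ : SimpleFunc E ℂ) :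
    ∫ ω, ∏ i ∈ Finset.range (n ω), φ (X i ω) ∂μ = Complex.exp (∫ x, (φ x - 1) ∂Λ) := by
  classical
  have hprod : ∀ ω, ∏ i ∈ Finset.range (n ω), φ (X i ω) =
      ∏ v ∈ φ.range, v ^ pointCount n X (φ ⁻¹' {v}) ω := by
    intro ω
    rw [← Finset.prod_fiberwise_of_maps_to (s := Finset.range (n ω)) (t := φ.range)
      (g := fun i => φ (X i ω)) fun i _ => φ.mem_range_self _]
    refine Finset.prod_congr rfl fun v _ => ?_
    rw [Finset.prod_congr rfl (g := fun _ => v) fun i hi => (Finset.mem_filter.mp hi).2,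
      Finset.prod_const]
    congr 1
  have hmeas : ∀ v : ℂ, MeasurableSet (φ ⁻¹' {v}) := fun v => φ.measurableSet_fiber v
  let e := φ.range.equivFin.symm
  have hind := h.count_indep _ (fun j => φ ⁻¹' {((e j : φ.range) : ℂ)}) (fun j => hmeas _) (by
    intro i j hij
    refine Disjoint.preimage _ (Set.disjoint_singleton.mpr fun heq => hij ?_)
    exact e.injective (Subtype.ext heq))
  have h1 := hind.integral_fun_prod_comp (f := fun j (k : ℕ) => ((e j : φ.range) : ℂ) ^ k)
    (fun j => (h.count_law _ (hmeas _)).aemeasurable)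
    (fun j => (measurable_of_countable _).aestronglyMeasurable)
  have h2 : ∀ v : ℂ, ∫ ω, v ^ pointCount n X (φ ⁻¹' {v}) ω ∂μ =
      Complex.exp (Λ.real (φ ⁻¹' {v}) * (v - 1)) := by
    intro v
    have := (h.count_law _ (hmeas v)).integral_comp (f := fun k : ℕ => v ^ k)
      (measurable_of_countable _).aestronglyMeasurable
    rw [integral_pow_poissonMeasure] at this
    exact this
  have h3 : ∫ x, (φ x - 1) ∂Λ = ∑ v ∈ φ.range, Λ.real (φ ⁻¹' {v}) * (v - 1) := by
    have hφ : Integrable φ Λ := SimpleFunc.integrable_of_isFiniteMeasure φ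
    rw [integral_sub hφ (integrable_const _), ← SimpleFunc.integral_eq_integral φ hφ,
      SimpleFunc.integral_def, integral_const]
    simp only [mul_sub, Finset.sum_sub_distrib, mul_one, Complex.real_smul]
    congr 1
    rw [← Complex.ofReal_sum]
    congr 1
    rw [sum_measureReal_preimage_singleton _ (fun v _ => hmeas v)]
    congr 1
    ext x
    simp
  simp_rw [hprod]
  rw [h3, Complex.exp_sum]
  have h4 : ∀ g : ℂ → ℂ, ∏ v ∈ φ.range, g v = ∏ j, g ((e j : φ.range) : ℂ) := by
    intro g
    rw [← Finset.prod_coe_sort, ← Equiv.prod_comp e]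
  rw [h4]
  simp_rw [h4]
  rw [h1]
  exact Finset.prod_congr rfl fun j _ => h2 _

/-- Simple approximations taking values in the closed unit disk keep all products bounded by $1$, so
dominated convergence applies to both sides. -/
theorem integral_prod [IsProbabilityMeasure μ] (h : IsPoissonProcess μ Λ n X) {ψ : E → ℂ}
    (hψ : Measurable ψ)
    (hb : ∀ x, ‖ψ x‖ ≤ 1) :
    ∫ ω, ∏ i ∈ Finset.range (n ω), ψ (X i ω) ∂μ = Complex.exp (∫ x, (ψ x - 1) ∂Λ) := by
  have h0 : (0 : ℂ) ∈ Metric.closedBall (0 : ℂ) 1 := by simp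
  let φ := SimpleFunc.approxOn ψ hψ (Metric.closedBall (0 : ℂ) 1) 0 h0
  have hφ1 : ∀ k x, ‖φ k x‖ ≤ 1 := fun k x => by
    simpa using SimpleFunc.approxOn_mem hψ h0 k x
  have hφt : ∀ x, Tendsto (fun k => φ k x) atTop (𝓝 (ψ x)) := fun x =>
    SimpleFunc.tendsto_approxOn hψ h0 (subset_closure (by simpa using hb x))
  have t1 : Tendsto (fun k => ∫ ω, ∏ i ∈ Finset.range (n ω), φ k (X i ω) ∂μ) atTop
      (𝓝 (∫ ω, ∏ i ∈ Finset.range (n ω), ψ (X i ω) ∂μ)) := by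
    refine tendsto_integral_of_dominated_convergence (fun _ => (1 : ℝ)) (fun k => ?_)
      (integrable_const _) (fun k => ?_) ?_
    · exact (measurable_comp_of_countable
        (F := fun j ω => ∏ i ∈ Finset.range j, φ k (X i ω)) h.measurable_card fun j =>
        Finset.measurable_fun_prod _ fun i _ =>
          (φ k).measurable.comp (h.measurable_point i)).aestronglyMeasurable
    · exact Eventually.of_forall fun ω => norm_prod_le_one _ fun i => hφ1 _ _
    · exact Eventually.of_forall fun ω => tendsto_finsetProd _ fun i _ => hφt _
  have t2 : Tendsto (fun k => Complex.exp (∫ x, (φ k x - 1) ∂Λ)) atTop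
      (𝓝 (Complex.exp (∫ x, (ψ x - 1) ∂Λ))) := by
    refine (Complex.continuous_exp.tendsto _).comp ?_
    refine tendsto_integral_of_dominated_convergence (fun _ => (2 : ℝ)) (fun k => ?_)
      (integrable_const _) (fun k => ?_) ?_
    · exact ((φ k).measurable.sub_const 1).aestronglyMeasurable
    · refine Eventually.of_forall fun x => (norm_sub_le _ _).trans ?_
      rw [norm_one]
      linarith [hφ1 k x]
    · exact Eventually.of_forall fun x => (hφt x).sub_const 1
  refine tendsto_nhds_unique t1 (t2.congr fun k => ?_)
  exact (h.integral_prod_simpleFunc (φ k)).symm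

end IsPoissonProcess

/-! ### The gamma distribution -/

lemma integrableOn_pow_mul_exp_neg {a : ℝ} (ha : 0 < a) (n : ℕ) :
    IntegrableOn (fun t : ℝ => t ^ n * Real.exp (-a * t)) (Set.Ioi 0) := by
  have := integrableOn_rpow_mul_exp_neg_mul_rpow (p := 1) (s := n) (b := a)
    (by have : (0 : ℝ) ≤ n := n.cast_nonneg
        linarith) one_pos ha
  simpa using this

lemma norm_pow_mul_cexp {t : ℝ} (ht : 0 < t) (n : ℕ) (z : ℂ) :
    ‖(t : ℂ) ^ n * Complex.exp (-z * t)‖ = t ^ n * Real.exp (-z.re * t) := by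
  rw [norm_mul, norm_pow, Complex.norm_real, Real.norm_of_nonneg ht.le, Complex.norm_exp]
  simp

lemma integrableOn_pow_mul_cexp_neg {z : ℂ} (hz : 0 < z.re) (n : ℕ) :
    IntegrableOn (fun t : ℝ => (t : ℂ) ^ n * Complex.exp (-z * t)) (Set.Ioi 0) := by
  refine Integrable.mono' (integrableOn_pow_mul_exp_neg hz n)
    (Continuous.aestronglyMeasurable (by fun_prop)) ?_
  filter_upwards [ae_restrict_mem measurableSet_Ioi] with t ht
  exact (norm_pow_mul_cexp ht n z).le

lemma integral_pow_mul_cexp_neg {z : ℂ} (hz : 0 < z.re) (n : ℕ) :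
    ∫ t in Set.Ioi (0 : ℝ), (t : ℂ) ^ n * Complex.exp (-z * t) = n.factorial / z ^ (n + 1) := by
  have hz0 : z ≠ 0 := fun h => by simp [h] at hz
  induction n with
  | zero =>
    simp only [pow_zero, one_mul]
    rw [integral_exp_mul_complex_Ioi (by simpa using hz)]
    simp
  | succ n ih =>
    have hu : ∀ t : ℝ, HasDerivAt (fun t : ℝ => (t : ℂ) ^ (n + 1))
        (((n + 1 : ℕ) : ℂ) * (t : ℂ) ^ n) t := fun t => by
      simpa using (hasDerivAt_pow (n + 1) (t : ℂ)).comp_ofReal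
    have hv : ∀ t : ℝ, HasDerivAt (fun t : ℝ => -(z⁻¹ * Complex.exp (-z * t)))
        (Complex.exp (-z * t)) t := by
      intro t
      have h1 : HasDerivAt (fun t : ℝ => -z * (t : ℂ)) (-z) t := by
        simpa using (Complex.ofRealCLM.hasDerivAt (x := t)).const_mul (-z)
      refine ((h1.cexp.const_mul z⁻¹).neg).congr_deriv ?_
      field_simp
    have hlim : Tendsto (fun t : ℝ => (t : ℂ) ^ (n + 1) * -(z⁻¹ * Complex.exp (-z * t))) atTop
        (𝓝 0) := by
      have h0 := (Real.tendsto_pow_mul_exp_neg_atTop_nhds_zero (n + 1)).comp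
        (tendsto_id.const_mul_atTop hz)
      have h1 := h0.const_mul ((z.re ^ (n + 1))⁻¹ * ‖z⁻¹‖)
      rw [mul_zero] at h1
      rw [tendsto_zero_iff_norm_tendsto_zero]
      refine h1.congr' ?_
      filter_upwards [eventually_gt_atTop 0] with t ht
      have h2 : ‖(t : ℂ) ^ (n + 1) * -(z⁻¹ * Complex.exp (-z * t))‖ =
          ‖z⁻¹‖ * ‖(t : ℂ) ^ (n + 1) * Complex.exp (-z * t)‖ := by
        rw [← norm_mul, ← norm_neg]
        congr 1
        ring
      rw [h2, norm_pow_mul_cexp ht]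
      simp only [Function.comp_apply, id, mul_pow, neg_mul]
      have := hz.ne'
      field_simp
    have hparts := integral_Ioi_mul_deriv_eq_deriv_mul (a := 0) (a' := 0) (b' := 0)
      (fun t _ => hu t) (fun t _ => hv t) (integrableOn_pow_mul_cexp_neg hz (n + 1)) ?_ ?_ hlim
    · rw [hparts]
      have : ∀ t : ℝ, ((n + 1 : ℕ) : ℂ) * (t : ℂ) ^ n * -(z⁻¹ * Complex.exp (-z * t)) =
          (-((n + 1 : ℕ) : ℂ) * z⁻¹) * ((t : ℂ) ^ n * Complex.exp (-z * t)) := fun t => by ring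
      simp_rw [this]
      rw [integral_const_mul, ih, Nat.factorial_succ]
      push_cast
      field_simp
      ring
    · have := (integrableOn_pow_mul_cexp_neg hz n).const_mul (-((n + 1 : ℕ) : ℂ) * z⁻¹)
      refine this.congr (Eventually.of_forall fun t => ?_)
      simp only [Pi.mul_apply]
      ring
    · have hc : Continuous fun t : ℝ => (t : ℂ) ^ (n + 1) * -(z⁻¹ * Complex.exp (-z * t)) := by
        fun_prop
      have := hc.tendsto 0
      simp only [Complex.ofReal_zero, zero_pow (Nat.succ_ne_zero n), zero_mul] at this
      exact this.mono_left nhdsWithin_le_nhds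

lemma measurable_gammaPDF (a r : ℝ) : Measurable (gammaPDF a r) :=
  (measurable_gammaPDFReal a r).ennreal_ofReal

lemma toReal_gammaPDF_of_nonneg (k : ℕ) {x : ℝ} (hx : 0 ≤ x) :
    (gammaPDF ((k + 1 : ℕ) : ℝ) ((k + 1 : ℕ) : ℝ) x).toReal =
      ((k + 1 : ℕ) : ℝ) ^ (k + 1) / k.factorial * (x ^ k * Real.exp (-((k + 1 : ℕ) : ℝ) * x)) := by
  have hk : (0 : ℝ) < ((k + 1 : ℕ) : ℝ) := by positivity
  have hG : Real.Gamma ((k + 1 : ℕ) : ℝ) = k.factorial := by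
    push_cast
    exact Real.Gamma_nat_eq_factorial k
  have he : ((k + 1 : ℕ) : ℝ) - 1 = (k : ℝ) := by push_cast; ring
  rw [gammaPDF_of_nonneg hx, ENNReal.toReal_ofReal (by rw [hG]; positivity), hG, he,
    Real.rpow_natCast, Real.rpow_natCast, neg_mul, mul_assoc]

lemma toReal_gammaPDF_of_notMem (a r : ℝ) {x : ℝ} (hx : x ∉ Set.Ici (0 : ℝ)) :
    (gammaPDF a r x).toReal = 0 := by
  rw [gammaPDF_of_neg (by simpa using hx), ENNReal.toReal_zero]

/-- The characteristic function of the gamma distribution with shape `m` and rate `m`. -/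
lemma integral_cexp_gammaMeasure {m : ℕ} (hm : 1 ≤ m) (y : ℝ) :
    ∫ x, Complex.exp (Complex.I * ((m * y * x : ℝ) : ℂ)) ∂(gammaMeasure m m) =
      ((1 - Complex.I * (y : ℂ)) ^ m)⁻¹ := by
  obtain ⟨k, rfl⟩ : ∃ k, m = k + 1 := ⟨m - 1, by omega⟩
  have hk : (0 : ℝ) < ((k + 1 : ℕ) : ℝ) := by positivity
  unfold gammaMeasure
  rw [integral_withDensity_eq_integral_toReal_smul
    (measurable_gammaPDF _ _)
    (Eventually.of_forall fun x => ENNReal.ofReal_lt_top),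
    ← setIntegral_eq_integral_of_forall_compl_eq_zero (s := Set.Ici (0 : ℝ)) (fun x hx => by
      rw [toReal_gammaPDF_of_notMem _ _ hx, zero_smul]), integral_Ici_eq_integral_Ioi]
  -- Density and phase combine into the single exponential $e^{-zx}$, whose real part of $z$ is the
  -- rate $m=k+1>0$.
  set z : ℂ := ((k + 1 : ℕ) : ℂ) * (1 - Complex.I * (y : ℂ)) with hz
  have hzre : z.re = ((k + 1 : ℕ) : ℝ) := by
    rw [hz, ← Complex.ofReal_natCast, Complex.re_ofReal_mul]
    simp
  have h1 : ∀ x ∈ Set.Ioi (0 : ℝ), (gammaPDF ((k + 1 : ℕ) : ℝ) ((k + 1 : ℕ) : ℝ) x).toReal •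
      Complex.exp (Complex.I * ((((k + 1 : ℕ) : ℝ) * y * x : ℝ) : ℂ)) =
      ((((k + 1 : ℕ) : ℝ) ^ (k + 1) / k.factorial : ℝ) : ℂ) *
        ((x : ℂ) ^ k * Complex.exp (-z * x)) := by
    intro x hx
    rw [toReal_gammaPDF_of_nonneg k (le_of_lt hx), Complex.real_smul]
    have : Complex.exp (-z * x) = Complex.exp (-((k + 1 : ℕ) : ℂ) * x) *
        Complex.exp (Complex.I * ((((k + 1 : ℕ) : ℝ) * y * x : ℝ) : ℂ)) := by
      rw [← Complex.exp_add, hz]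
      congr 1
      push_cast
      ring
    rw [this]
    push_cast
    ring
  rw [setIntegral_congr_fun measurableSet_Ioi h1, integral_const_mul,
    integral_pow_mul_cexp_neg (by rw [hzre]; exact hk)]
  have hf : (k.factorial : ℂ) ≠ 0 := Nat.cast_ne_zero.mpr k.factorial_ne_zero
  have hk' : ((k + 1 : ℕ) : ℂ) ≠ 0 := Nat.cast_ne_zero.mpr k.succ_ne_zero
  have hne := one_sub_I_mul_ne_zero y
  rw [hz, mul_pow]
  push_cast at hk' ⊢
  field_simp

lemma integrable_id_gammaMeasure {m : ℕ} (hm : 1 ≤ m) :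
    Integrable (fun x : ℝ => x) (gammaMeasure m m) := by
  obtain ⟨k, rfl⟩ : ∃ k, m = k + 1 := ⟨m - 1, by omega⟩
  have hk : (0 : ℝ) < ((k + 1 : ℕ) : ℝ) := by positivity
  unfold gammaMeasure
  rw [integrable_withDensity_iff_integrable_smul' (measurable_gammaPDF _ _)
    (Eventually.of_forall fun x => ENNReal.ofReal_lt_top),
    ← integrableOn_iff_integrable_of_support_subset (s := Set.Ici (0 : ℝ)),
    integrableOn_Ici_iff_integrableOn_Ioi]
  · refine ((integrableOn_pow_mul_exp_neg hk (k + 1)).const_mul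
      (((k + 1 : ℕ) : ℝ) ^ (k + 1) / k.factorial)).congr ?_
    filter_upwards [ae_restrict_mem measurableSet_Ioi] with x hx
    rw [toReal_gammaPDF_of_nonneg k (le_of_lt hx), smul_eq_mul]
    ring
  · intro x hx
    by_contra h
    exact hx (by beta_reduce; rw [toReal_gammaPDF_of_notMem _ _ h, zero_smul])

lemma gammaMeasure_singleton (a r x : ℝ) : gammaMeasure a r {x} = 0 :=
  withDensity_absolutelyContinuous _ _ (by simp)

/-! ### Side lobes -/

/-- It suffices that the infimum defining $x_k$ lie strictly between the zeros $k\pi/N$ and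
$(k+1)\pi/N$ of $\sin(Nx)$; neither uniqueness nor attainment is needed. Since $\sqrt3<2$, the lobe
lies in $(0,\pi/2)$. -/
lemma lobePeak_ne_zero {N k : ℕ} (hk : (k : ℝ) + 1 ≤ N * Real.sqrt 3 / 4) : lobePeak N k ≠ 0 := by
  unfold lobePeak
  split_ifs with hk0
  · exact one_ne_zero
  have hπ := Real.pi_pos
  have hk1 : (1 : ℝ) ≤ k := by exact_mod_cast Nat.one_le_iff_ne_zero.mpr hk0
  have hs3 : Real.sqrt 3 < 2 := by
    rw [Real.sqrt_lt' (by norm_num)]; norm_num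
  have hs0 : 0 < Real.sqrt 3 := by positivity
  have hN : (0 : ℝ) < N := by
    by_contra h
    have : (N : ℝ) = 0 := le_antisymm (not_lt.mp h) N.cast_nonneg
    rw [this] at hk
    linarith
  have hkN : 2 * ((k : ℝ) + 1) < N := by nlinarith
  set a : ℝ := k * Real.pi / N with ha
  set b : ℝ := (k + 1) * Real.pi / N with hb
  have hNa : N * a = k * Real.pi := by rw [ha]; field_simp
  have hNb : N * b = (k + 1) * Real.pi := by rw [hb]; field_simp
  have ha0 : 0 < a := by positivity
  have hbpi : b < Real.pi / 2 := by
    rw [hb, div_lt_div_iff₀ hN two_pos]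
    nlinarith
  have hab : a < b := by
    rw [ha, hb]
    gcongr
    linarith
  set S : Set ℝ := {x : ℝ | a < x ∧ x < b ∧ N * Real.tan x = Real.tan (N * x)} with hS
  have hsign : ((-1 : ℝ) ^ k) * (-1) ^ k = 1 := by
    rw [← mul_pow]; norm_num
  have hcosk : Real.cos (k * Real.pi) = (-1) ^ k := by
    simpa using Real.cos_nat_mul_pi k
  have hne : S.Nonempty := by
    set c : ℝ := (k + 1 / 2) * Real.pi / N with hc
    have hNc : N * c = k * Real.pi + Real.pi / 2 := by rw [hc]; field_simp
    have hac : a < c := by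
      rw [ha, hc]
      gcongr
      linarith
    have hcb : c < b := by
      rw [hb, hc]
      gcongr
      linarith
    -- Clearing the cosines removes the poles of the tangents, and the sign $(-1)^k$ normalizes the
    -- lobe: $F=N\sin a>0$ at its left end and $F=-\cos c<0$ at its midpoint.
    let F : ℝ → ℝ := fun x =>
      (-1) ^ k * (N * Real.sin x * Real.cos (N * x) - Real.cos x * Real.sin (N * x))
    have hFa : 0 < F a := by
      simp only [F, hNa, hcosk, Real.sin_nat_mul_pi]
      have := Real.sin_pos_of_pos_of_lt_pi ha0 (by linarith)
      have e : (-1 : ℝ) ^ k * (N * Real.sin a * (-1) ^ k - Real.cos a * 0) =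
          N * Real.sin a * ((-1) ^ k * (-1) ^ k) := by ring
      rw [e, hsign]
      positivity
    have hFc : F c < 0 := by
      simp only [F, hNc, Real.cos_add_pi_div_two, Real.sin_add_pi_div_two, Real.sin_nat_mul_pi,
        hcosk]
      have := Real.cos_pos_of_mem_Ioo ⟨by linarith, by linarith⟩ (x := c)
      have e : (-1 : ℝ) ^ k * (N * Real.sin c * -0 - Real.cos c * (-1) ^ k) =
          -(Real.cos c * ((-1) ^ k * (-1) ^ k)) := by ring
      rw [e, hsign]
      linarith
    obtain ⟨x, hx, hFx⟩ := intermediate_value_Icc' hac.le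
      (f := F) (by fun_prop) ⟨hFc.le, hFa.le⟩
    have hxa : a < x := by
      refine lt_of_le_of_ne hx.1 fun h => ?_
      rw [← h] at hFx
      linarith
    have hcx : 0 < Real.cos x :=
      Real.cos_pos_of_mem_Ioo ⟨by linarith, by linarith [hx.2]⟩
    have hf : N * Real.sin x * Real.cos (N * x) - Real.cos x * Real.sin (N * x) = 0 :=
      (mul_eq_zero.mp hFx).resolve_left (pow_ne_zero _ (by norm_num))
    have hcNx : Real.cos (N * x) ≠ 0 := by
      intro h
      rw [h, mul_zero, zero_sub, neg_eq_zero, mul_eq_zero] at hf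
      have h1 := hf.resolve_left hcx.ne'
      have := Real.sin_sq_add_cos_sq (N * x)
      rw [h, h1] at this
      norm_num at this
    refine ⟨x, hxa, hx.2.trans_lt hcb, ?_⟩
    rw [Real.tan_eq_sin_div_cos, Real.tan_eq_sin_div_cos]
    field_simp
    linarith
  -- Near $a$ the function $N\tan x-\tan(Nx-k\pi)$ is close to $N\tan a>0$, while it vanishes on
  -- `S`. Hence the infimum cannot slip down to $a$.
  have hlow : ∃ ε > 0, ∀ x ∈ S, a + ε ≤ x := by
    have hcont : ContinuousAt (fun x : ℝ => N * Real.tan x - Real.tan (N * x - k * Real.pi)) a := by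
      have h1 : ContinuousAt Real.tan a := Real.continuousAt_tan.mpr
        (Real.cos_pos_of_mem_Ioo ⟨by linarith, by linarith⟩).ne'
      have h2 : ContinuousAt Real.tan (N * a - k * Real.pi) := Real.continuousAt_tan.mpr (by
        rw [hNa, sub_self]; simp)
      exact (continuousAt_const.mul h1).sub
        (ContinuousAt.comp (f := fun x : ℝ => N * x - k * Real.pi) h2 (by fun_prop))
    have hpos : 0 < N * Real.tan a - Real.tan (N * a - k * Real.pi) := by
      rw [hNa, sub_self, Real.tan_zero, sub_zero]
      exact mul_pos hN (Real.tan_pos_of_pos_of_lt_pi_div_two ha0 (by linarith))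
    obtain ⟨ε, hε, hball⟩ := Metric.eventually_nhds_iff.mp
      (hcont.eventually (lt_mem_nhds hpos))
    refine ⟨ε, hε, fun x hx => ?_⟩
    by_contra! hlt
    have := hball (y := x) (by
      rw [Real.dist_eq, abs_of_pos (by linarith [hx.1])]
      linarith)
    rw [Real.tan_sub_nat_mul_pi, hx.2.2, sub_self] at this
    exact lt_irrefl _ this
  obtain ⟨ε, hε, hlow⟩ := hlow
  have harg : lobeArg N k = sInf S := rfl
  obtain ⟨x₀, hx₀⟩ := hne
  have h1 : a < lobeArg N k := by
    rw [harg]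
    linarith [le_csInf ⟨x₀, hx₀⟩ hlow]
  have h2 : lobeArg N k < b := by
    rw [harg]
    exact (csInf_le ⟨a, fun x hx => hx.1.le⟩ hx₀).trans_lt hx₀.2.1
  have hsin1 : 0 < Real.sin (lobeArg N k) :=
    Real.sin_pos_of_pos_of_lt_pi (by linarith) (by linarith)
  have hsin2 : Real.sin (N * lobeArg N k) ≠ 0 := by
    have h3 : 0 < Real.sin (N * lobeArg N k - k * Real.pi) := by
      refine Real.sin_pos_of_pos_of_lt_pi ?_ ?_
      · rw [← hNa]
        nlinarith
      · have : N * lobeArg N k < (k + 1) * Real.pi := by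
          rw [← hNb]
          nlinarith
        linarith
    rw [Real.sin_sub_nat_mul_pi] at h3
    intro h
    rw [h, mul_zero] at h3
    exact lt_irrefl _ h3
  positivity

/-! ### Integrals over the antenna pattern -/

lemma multiCosGain_neg (N K : ℕ) (φ : ℝ) : multiCosGain N K (-φ) = multiCosGain N K φ := by
  unfold multiCosGain
  simp only [abs_neg, mul_neg, neg_div, Real.cos_neg, Real.sin_neg, neg_sq]

lemma measurable_multiCosGain (N K : ℕ) : Measurable (multiCosGain N K) := by
  unfold multiCosGain
  refine Measurable.ite (measurableSet_le (by fun_prop) measurable_const) (by fun_prop) ?_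
  refine Measurable.ite (measurableSet_lt (by fun_prop) measurable_const) ?_ measurable_const
  refine Measurable.mul ?_ (by fun_prop)
  have : Measurable fun φ : ℝ => ⌊N * |φ| / 2⌋₊ := Nat.measurable_floor.comp (by fun_prop)
  exact (measurable_of_countable (lobePeak N)).comp this

lemma lobePeak_nonneg (N k : ℕ) : 0 ≤ lobePeak N k := by
  unfold lobePeak
  split_ifs <;> positivity

lemma multiCosGain_nonneg (N K : ℕ) (φ : ℝ) : 0 ≤ multiCosGain N K φ := by
  unfold multiCosGain
  have := lobePeak_nonneg N ⌊N * |φ| / 2⌋₊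
  split_ifs <;> positivity

lemma floor_lobe_lt {N K : ℕ} {φ : ℝ} (h : |φ| < (2 * K + 2) / N) :
    ⌊N * |φ| / 2⌋₊ < K + 1 := by
  have hN : (0 : ℝ) < N := by
    rcases Nat.eq_zero_or_pos N with rfl | hN
    · simp only [Nat.cast_zero, div_zero] at h
      exact absurd h (not_lt.mpr (abs_nonneg _))
    · exact_mod_cast hN
  rw [Nat.floor_lt (by positivity)]
  rw [lt_div_iff₀ hN] at h
  push_cast
  linarith

lemma exists_multiCosGain_le (N K : ℕ) : ∃ C, ∀ φ, multiCosGain N K φ ≤ C := by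
  have hsum : 0 ≤ ∑ k ∈ Finset.range (K + 1), lobePeak N k :=
    Finset.sum_nonneg fun k _ => lobePeak_nonneg N k
  refine ⟨1 + ∑ k ∈ Finset.range (K + 1), lobePeak N k, fun φ => ?_⟩
  unfold multiCosGain
  split_ifs with h1 h2
  · linarith [Real.cos_sq_le_one (N * Real.pi * φ / 4)]
  · have h3 : lobePeak N ⌊N * |φ| / 2⌋₊ ≤ ∑ k ∈ Finset.range (K + 1), lobePeak N k :=
      Finset.single_le_sum (f := lobePeak N) (fun k _ => lobePeak_nonneg N k)
        (Finset.mem_range.mpr (floor_lobe_lt h2))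
    have h4 := mul_le_of_le_one_right (lobePeak_nonneg N ⌊N * |φ| / 2⌋₊)
      (Real.sin_sq_le_one (N * Real.pi * φ / 2))
    linarith
  · linarith

section GainIntegral

variable {g : ℝ → ℂ}

/-- $\sin^2$ has period $\pi$ and is symmetric about $\pi/2$. -/
lemma integral_sin_sq_half (hg : Continuous g) (c : ℝ) (k : ℕ) :
    ∫ θ in (k * Real.pi)..((k + 1) * Real.pi), g (c * Real.sin θ ^ 2) =
      2 * ∫ θ in (0 : ℝ)..(Real.pi / 2), g (c * Real.sin θ ^ 2) := by
  have hper : Function.Periodic (fun θ => g (c * Real.sin θ ^ 2)) Real.pi := fun θ => by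
    simp only [Real.sin_add_pi, neg_sq]
  have hcont : Continuous fun θ => g (c * Real.sin θ ^ 2) := hg.comp (by fun_prop)
  have h1 := hper.intervalIntegral_add_eq (k * Real.pi) 0
  rw [zero_add] at h1
  rw [add_one_mul, h1, ← intervalIntegral.integral_add_adjacent_intervals
    (hcont.intervalIntegrable 0 (Real.pi / 2)) (hcont.intervalIntegrable _ _), two_mul]
  congr 1
  have := intervalIntegral.integral_comp_sub_left (a := 0) (b := Real.pi / 2)
    (fun θ => g (c * Real.sin θ ^ 2)) Real.pi
  simp only [Real.sin_pi_sub, sub_zero] at this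
  rw [this]
  congr 1
  ring

/-- The mean of `g (c sin² θ)`. -/
def sinSqMean (g : ℝ → ℂ) (c : ℝ) : ℂ :=
  ((2 / Real.pi : ℝ) : ℂ) * ∫ θ in (0 : ℝ)..(Real.pi / 2), g (c * Real.sin θ ^ 2)

lemma integral_cos_sq_eq_integral_sin_sq (g : ℝ → ℂ) :
    ∫ θ in (0 : ℝ)..(Real.pi / 2), g (Real.cos θ ^ 2) =
      ∫ θ in (0 : ℝ)..(Real.pi / 2), g (Real.sin θ ^ 2) := by
  have := intervalIntegral.integral_comp_sub_left (a := 0) (b := Real.pi / 2)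
    (fun θ => g (Real.sin θ ^ 2)) (Real.pi / 2)
  simp only [Real.sin_pi_div_two_sub, sub_zero, sub_self] at this
  exact this

/-- Each piece has width $2/N$. It is a quarter period of the cosine for the main lobe and a half
period of the sine for a side lobe, so in both cases the average is that of $g(\chi_k\sin^2\theta)$.
Only the open interval matters, which avoids the switch of formula at the endpoints. -/
lemma integral_multiCosGain_lobe {N K k : ℕ} (hN : 0 < N) (hk : k ≤ K) (hg : Continuous g) :
    ∫ φ in (2 * (k : ℕ) / N : ℝ)..(2 * (k + 1 : ℕ) / N), (g (multiCosGain N K φ) - 1) =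
      2 / N * (sinSqMean g (lobePeak N k) - 1) := by
  have hN' : (0 : ℝ) < N := by exact_mod_cast hN
  have hNc : (N : ℂ) ≠ 0 := Nat.cast_ne_zero.mpr hN.ne'
  have hπ := Real.pi_pos
  have hπc : (Real.pi : ℂ) ≠ 0 := Complex.ofReal_ne_zero.mpr hπ.ne'
  have hle : (2 * (k : ℕ) / N : ℝ) ≤ 2 * (k + 1 : ℕ) / N := by
    push_cast
    gcongr
    linarith
  suffices hmain : ∃ f : ℝ → ℂ, Continuous f ∧
      (∀ φ ∈ Set.Ioo (2 * (k : ℕ) / N : ℝ) (2 * (k + 1 : ℕ) / N), g (multiCosGain N K φ) = f φ) ∧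
      ∫ φ in (2 * (k : ℕ) / N : ℝ)..(2 * (k + 1 : ℕ) / N), f φ =
        2 / N * sinSqMean g (lobePeak N k) by
    obtain ⟨f, hf, hfg, hfint⟩ := hmain
    have : ∫ φ in (2 * (k : ℕ) / N : ℝ)..(2 * (k + 1 : ℕ) / N), (g (multiCosGain N K φ) - 1) =
        ∫ φ in (2 * (k : ℕ) / N : ℝ)..(2 * (k + 1 : ℕ) / N), (f φ - 1) := by
      rw [intervalIntegral.integral_of_le hle, intervalIntegral.integral_of_le hle,
        integral_Ioc_eq_integral_Ioo, integral_Ioc_eq_integral_Ioo]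
      exact setIntegral_congr_fun measurableSet_Ioo fun φ hφ => by rw [hfg φ hφ]
    rw [this, intervalIntegral.integral_sub (hf.intervalIntegrable _ _) (by simp), hfint,
      intervalIntegral.integral_const, Complex.real_smul]
    push_cast
    field_simp
    ring
  rcases Nat.eq_zero_or_pos k with rfl | hk0
  · refine ⟨fun φ => g (Real.cos (N * Real.pi / 4 * φ) ^ 2), hg.comp (by fun_prop), ?_, ?_⟩
    · intro φ hφ
      have h1 : 0 < φ := by simpa using hφ.1
      have h2 : |φ| ≤ 2 / N := by
        rw [abs_of_pos h1]
        simpa using hφ.2.le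
      unfold multiCosGain
      rw [if_pos h2]
      ring_nf
    · rw [intervalIntegral.integral_comp_mul_left (fun u => g (Real.cos u ^ 2))
        (c := N * Real.pi / 4) (by positivity)]
      have e1 : N * Real.pi / 4 * (2 * ((0 : ℕ) : ℝ) / N) = 0 := by simp
      have e2 : N * Real.pi / 4 * (2 * ((0 + 1 : ℕ) : ℝ) / N) = Real.pi / 2 := by
        push_cast
        field_simp
        ring
      rw [e1, e2, integral_cos_sq_eq_integral_sin_sq, sinSqMean, lobePeak, if_pos rfl,
        Complex.real_smul]
      simp only [one_mul]
      push_cast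
      field_simp
      ring
  · refine ⟨fun φ => g (lobePeak N k * Real.sin (N * Real.pi / 2 * φ) ^ 2),
      hg.comp (by fun_prop), ?_, ?_⟩
    · intro φ hφ
      have hk1 : (1 : ℝ) ≤ k := by exact_mod_cast hk0
      have hkK : (k : ℝ) ≤ K := by exact_mod_cast hk
      have h0 : 0 < φ := lt_of_le_of_lt (by positivity) hφ.1
      have h1 := hφ.1
      have h2 := hφ.2
      rw [div_lt_iff₀ hN'] at h1
      rw [lt_div_iff₀ hN'] at h2
      push_cast at h2
      have h3 : ¬ |φ| ≤ 2 / N := by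
        rw [abs_of_pos h0, not_le, div_lt_iff₀ hN']
        linarith
      have h4 : |φ| < (2 * K + 2) / N := by
        rw [abs_of_pos h0, lt_div_iff₀ hN']
        linarith
      have h5 : ⌊N * |φ| / 2⌋₊ = k := by
        rw [abs_of_pos h0, Nat.floor_eq_iff (by positivity)]
        constructor <;> linarith
      unfold multiCosGain
      rw [if_neg h3, if_pos h4, h5]
      ring_nf
    · rw [intervalIntegral.integral_comp_mul_left (fun u => g (lobePeak N k * Real.sin u ^ 2))
        (c := N * Real.pi / 2) (by positivity)]
      have e1 : N * Real.pi / 2 * (2 * (k : ℝ) / N) = k * Real.pi := by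
        field_simp
      have e2 : N * Real.pi / 2 * (2 * ((k + 1 : ℕ) : ℝ) / N) = (k + 1) * Real.pi := by
        push_cast
        field_simp
      rw [e1, e2, integral_sin_sq_half hg, sinSqMean, Complex.real_smul]
      push_cast
      field_simp

lemma intervalIntegrable_multiCosGain (N K : ℕ) (hg : Continuous g) (hg1 : ∀ x, ‖g x‖ ≤ 1)
    (a b : ℝ) : IntervalIntegrable (fun φ => g (multiCosGain N K φ) - 1) volume a b := by
  refine IntervalIntegrable.mono_fun' (g := fun _ => (2 : ℝ)) (by simp)
    ((hg.measurable.comp (measurable_multiCosGain N K)).sub_const 1).aestronglyMeasurable ?_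
  refine Eventually.of_forall fun φ => (norm_sub_le _ _).trans ?_
  rw [norm_one]
  linarith [hg1 (multiCosGain N K φ)]

/-- Evenness doubles the sum over the positive pieces. They end before $1<\pi/3$, and beyond them
the gain is $0$; subtracting $1=g(0)$ makes that tail vanish. -/
lemma integral_multiCosGain {N K : ℕ} (hK : (K : ℝ) + 1 ≤ N * Real.sqrt 3 / 4)
    (hg : Continuous g) (hg1 : ∀ x, ‖g x‖ ≤ 1) (hg0 : g 0 = 1) :
    ∫ φ in (-(Real.pi / 3))..(Real.pi / 3), (g (multiCosGain N K φ) - 1) =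
      4 / N * ∑ k ∈ Finset.range (K + 1), (sinSqMean g (lobePeak N k) - 1) := by
  have hi := fun a b => intervalIntegrable_multiCosGain N K hg hg1 a b
  have hN : 0 < N := by
    rcases Nat.eq_zero_or_pos N with rfl | hN
    · have : (0 : ℝ) ≤ K := K.cast_nonneg
      simp only [Nat.cast_zero, zero_mul, zero_div] at hK
      linarith
    · exact hN
  have hN' : (0 : ℝ) < N := by exact_mod_cast hN
  have hs3 : Real.sqrt 3 < 2 := by
    rw [Real.sqrt_lt' (by norm_num)]; norm_num
  have hA : 2 * ((K + 1 : ℕ) : ℝ) / N ≤ Real.pi / 3 := by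
    have h1 : 2 * ((K + 1 : ℕ) : ℝ) / N ≤ 1 := by
      rw [div_le_one hN']
      push_cast
      nlinarith
    linarith [Real.pi_gt_three]
  have hneg : ∫ φ in (-(Real.pi / 3))..0, (g (multiCosGain N K φ) - 1) =
      ∫ φ in (0 : ℝ)..(Real.pi / 3), (g (multiCosGain N K φ) - 1) := by
    have := intervalIntegral.integral_comp_neg (a := 0) (b := Real.pi / 3)
      (fun φ => g (multiCosGain N K φ) - 1)
    simp only [multiCosGain_neg, neg_zero] at this
    exact this.symm
  have htail : ∫ φ in (2 * ((K + 1 : ℕ) : ℝ) / N)..(Real.pi / 3),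
      (g (multiCosGain N K φ) - 1) = 0 := by
    rw [intervalIntegral.integral_of_le hA, ← integral_zero ℝ ℂ (μ := volume.restrict _)]
    refine setIntegral_congr_fun measurableSet_Ioc fun φ hφ => ?_
    have h1 := hφ.1
    have hK0 : (0 : ℝ) ≤ K := K.cast_nonneg
    have h0 : 0 < φ := lt_of_le_of_lt (by positivity) h1
    rw [div_lt_iff₀ hN'] at h1
    push_cast at h1
    have h2 : ¬ |φ| ≤ 2 / N := by
      rw [abs_of_pos h0, not_le, div_lt_iff₀ hN']
      linarith
    have h3 : ¬ |φ| < (2 * K + 2) / N := by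
      rw [abs_of_pos h0, not_lt, div_le_iff₀ hN']
      linarith
    unfold multiCosGain
    rw [if_neg h2, if_neg h3, hg0, sub_self]
  have hsum := intervalIntegral.sum_integral_adjacent_intervals
    (f := fun φ => g (multiCosGain N K φ) - 1) (a := fun k : ℕ => 2 * (k : ℝ) / N) (n := K + 1)
    (μ := volume) fun k _ => hi _ _
  simp only [Nat.cast_zero, mul_zero, zero_div] at hsum
  rw [← intervalIntegral.integral_add_adjacent_intervals (hi _ 0) (hi _ _), hneg,
    ← intervalIntegral.integral_add_adjacent_intervals (hi 0 (2 * ((K + 1 : ℕ) : ℝ) / N)) (hi _ _),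
    htail, ← hsum, Finset.sum_congr rfl fun k hk => integral_multiCosGain_lobe hN
      (Nat.lt_succ_iff.mp (Finset.mem_range.mp hk)) hg, ← Finset.mul_sum]
  ring

end GainIntegral

/-! ### Atoms of sums of independent variables -/

section Atoms

variable {Ω : Type*} [MeasurableSpace Ω] {μ : Measure Ω} [IsProbabilityMeasure μ]

lemma IndepFun.measure_eq_zero_of_prod_null {β γ : Type*} [MeasurableSpace β] [MeasurableSpace γ]
    {A : Ω → β} {B : Ω → γ} (hA : Measurable A) (hB : Measurable B) (h : IndepFun A B μ)
    {s : Set (β × γ)} (hs : MeasurableSet s)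
    (hnull : ∀ᵐ a ∂(μ.map A), μ {ω | (a, B ω) ∈ s} = 0) : μ {ω | (A ω, B ω) ∈ s} = 0 := by
  have hmap := (indepFun_iff_map_prod_eq_prod_map_map hA.aemeasurable hB.aemeasurable).mp h
  have h1 : μ {ω | (A ω, B ω) ∈ s} = μ.map (fun ω => (A ω, B ω)) s :=
    (Measure.map_apply (hA.prodMk hB) hs).symm
  have := Measure.isProbabilityMeasure_map (μ := μ) hB.aemeasurable
  have := Measure.isProbabilityMeasure_map (μ := μ) hA.aemeasurable
  rw [h1, hmap, Measure.measure_prod_null hs]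
  filter_upwards [hnull] with a ha
  rw [Measure.map_apply hB (measurable_prodMk_left hs)]
  exact ha

/-- Given $B=b$, the event is impossible for $b=0$ because $x\ne0$, and otherwise it is the null
event $g=x/b$. Thus $B$ may itself have atoms, including one at $0$. -/
lemma measure_mul_eq_zero {B g : Ω → ℝ} (hB : Measurable B) (hg : Measurable g)
    (h : IndepFun B g μ) (hatom : ∀ x, μ {ω | g ω = x} = 0) {x : ℝ} (hx : x ≠ 0) :
    μ {ω | B ω * g ω = x} = 0 := by
  refine IndepFun.measure_eq_zero_of_prod_null hB hg h (s := {z : ℝ × ℝ | z.1 * z.2 = x})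
    (measurableSet_eq_fun (by fun_prop) measurable_const) (Eventually.of_forall fun b => ?_)
  rcases eq_or_ne b 0 with rfl | hb
  · simp [hx.symm]
  · refine measure_mono_null (fun ω hω => ?_) (hatom (x / b))
    simp only [Set.mem_ofPred_eq] at hω ⊢
    rw [eq_div_iff hb, mul_comm]
    exact hω

/-- Condition on the partial sum $a$: almost surely $a\ne T$ by induction, and then the last term
would have to equal $T-a\ne0$, which is not an atom. -/
lemma measure_sum_eq_zero {V : ℕ → Ω → ℝ} (hV : ∀ i, Measurable (V i)) (hind : iIndepFun V μ)
    (hatom : ∀ i x, x ≠ 0 → μ {ω | V i ω = x} = 0) (k : ℕ) {T : ℝ} (hT : T ≠ 0) :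
    μ {ω | ∑ i ∈ Finset.range k, V i ω = T} = 0 := by
  induction k with
  | zero => simp [hT.symm]
  | succ k ih =>
    have hS : Measurable fun ω => ∑ i ∈ Finset.range k, V i ω :=
      Finset.measurable_fun_sum _ fun i _ => hV i
    have h1 : IndepFun (fun ω => ∑ i ∈ Finset.range k, V i ω) (V k) μ := by
      have := hind.indepFun_finsetSum_of_notMem hV (Finset.notMem_range_self (n := k))
      convert this using 1
      funext ω
      simp
    simp_rw [Finset.sum_range_succ]
    refine IndepFun.measure_eq_zero_of_prod_null hS (hV k) h1 (s := {z : ℝ × ℝ | z.1 + z.2 = T})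
      (measurableSet_eq_fun (by fun_prop) measurable_const) ?_
    have hae : ∀ᵐ a ∂(μ.map fun ω => ∑ i ∈ Finset.range k, V i ω), a ≠ T := by
      rw [ae_iff]
      simp only [not_not]
      exact (Measure.map_apply hS (measurableSet_singleton T)).trans ih
    filter_upwards [hae] with a ha
    refine measure_mono_null (fun ω hω => ?_) (hatom k (T - a) (sub_ne_zero.mpr ha.symm))
    simp only [Set.mem_ofPred_eq] at hω ⊢
    linarith

end Atoms

/-! ### The Poisson exponent in closed form -/

namespace NetworkParams

variable {p : NetworkParams}

lemma Admissible.continuous_Sbar (hp : p.Admissible) : Continuous p.Sbar :=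
  continuous_iff_continuousAt.mpr fun r => (hp.hasDerivAt_Sbar r).continuousAt

lemma Admissible.Sbar_le (hp : p.Admissible) (r : ℝ) : p.Sbar r ≤ p.Sbar 0 := by
  have h1 := hp.κ_pos
  have h2 := hp.Pt_pos
  have h3 := hp.z_pos
  have h4 : (r ^ 2 + p.z ^ 2) ^ (-p.α / 2) ≤ (0 ^ 2 + p.z ^ 2) ^ (-p.α / 2) :=
    Real.rpow_le_rpow_of_nonpos (by positivity) (by nlinarith) (by linarith [hp.α_gt])
  unfold Sbar pathLoss
  gcongr

/-- The function whose values at `‖X i‖` are the conditional characteristic functions of the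
summands of the exposure. -/
def pointCF (p : NetworkParams) (q r : ℝ) : ℂ :=
  1 + 6 / (Real.pi * p.N) *
    ∑ k ∈ Finset.range (p.kmax + 1), (lobeMean p.m (p.cfArgIm k q r) - 1)

lemma Admissible.continuous_pointCF (hp : p.Admissible) (q : ℝ) : Continuous (p.pointCF q) := by
  refine continuous_const.add (continuous_const.mul (continuous_finsetSum _ fun k _ => ?_))
  exact ((continuous_lobeMean _).comp (hp.continuous_cfArgIm k q)).sub continuous_const

lemma Admissible.lobePeak_ne_zero (hp : p.Admissible) {k : ℕ} (hk : k ∈ Finset.range (p.kmax + 1)) :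
    lobePeak p.N k ≠ 0 := by
  refine _root_.lobePeak_ne_zero (le_trans ?_ hp.lobes)
  have : (k : ℝ) ≤ p.kmax := by
    exact_mod_cast Nat.lt_succ_iff.mp (Finset.mem_range.mp hk)
  linarith

lemma integral_intensity_norm (hlam : 0 ≤ p.lam) (hre : 0 ≤ p.re) (hτ : p.re ≤ p.τ) (f : ℝ → ℂ) :
    ∫ x, f ‖x‖ ∂p.intensity =
      ((2 * Real.pi * p.lam : ℝ) : ℂ) * ∫ r in p.re..p.τ, (r : ℂ) * f r := by
  have hmeas : MeasurableSet p.region := by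
    have : p.region = norm ⁻¹' Set.Icc p.re p.τ := rfl
    rw [this]
    exact measurable_norm measurableSet_Icc
  have h1 : ∫ x in p.region, f ‖x‖ =
      ∫ x : EuclideanSpace ℝ (Fin 2), (Set.Icc p.re p.τ).indicator f ‖x‖ := by
    rw [← integral_indicator hmeas]
    rfl
  have h2 : (volume : Measure (EuclideanSpace ℝ (Fin 2))).real (Metric.ball 0 1) = Real.pi := by
    rw [measureReal_def, EuclideanSpace.volume_ball_fin_two]
    simp [Real.pi_pos.le]
  have h3 : ∫ y in Set.Ioi (0 : ℝ), y ^ (2 - 1) • (Set.Icc p.re p.τ).indicator f y =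
      ∫ r in p.re..p.τ, (r : ℂ) * f r := by
    rw [← integral_Ici_eq_integral_Ioi, intervalIntegral.integral_of_le hτ,
      ← integral_Icc_eq_integral_Ioc]
    have : ∀ y : ℝ, y ^ (2 - 1) • (Set.Icc p.re p.τ).indicator f y =
        (Set.Icc p.re p.τ).indicator (fun r : ℝ => (r : ℂ) * f r) y := by
      intro y
      by_cases hy : y ∈ Set.Icc p.re p.τ <;> simp [hy]
    simp_rw [this]
    rw [setIntegral_indicator measurableSet_Icc]
    congr 2
    exact Set.inter_eq_right.mpr fun y hy => hre.trans hy.1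
  unfold intensity
  rw [integral_smul_measure, h1, integral_fun_norm_addHaar, finrank_euclideanSpace_fin, h2, h3,
    ENNReal.toReal_ofReal hlam]
  simp only [Complex.real_smul, nsmul_eq_mul]
  push_cast
  ring

/-- Polar coordinates contribute $2\pi\lambda$ and the angular law $6/(\pi N)$, together
$12\lambda/N$. Per lobe, the radial integral is $-2$ times the sum over $l$ minus
$(\tau^2-r_e^2)/2$, whence the constants $24$ and $6$. -/
lemma Admissible.exp_integral_pointCF (hp : p.Admissible) {q : ℝ} (hq : q ≠ 0) :
    Complex.exp (∫ x, (p.pointCF q ‖x‖ - 1) ∂p.intensity) = p.exposureCF q := by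
  unfold exposureCF
  congr 1
  rw [integral_intensity_norm hp.lam_pos.le hp.re_nonneg hp.re_lt.le
    (fun r => p.pointCF q r - 1)]
  have hc : ∀ k, Continuous fun r : ℝ => (r : ℂ) * lobeMean p.m (p.cfArgIm k q r) := fun k =>
    Complex.continuous_ofReal.mul ((continuous_lobeMean _).comp (hp.continuous_cfArgIm k q))
  have h1 : ∀ k ∈ Finset.range (p.kmax + 1),
      ∫ r in p.re..p.τ, (r : ℂ) * (lobeMean p.m (p.cfArgIm k q r) - 1) =
        -2 * ∑ l ∈ Finset.range p.m, (p.cfTerm k l q p.τ - p.cfTerm k l q p.re) -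
          (p.τ ^ 2 - p.re ^ 2) / 2 := by
    intro k hk
    have h2 : ∫ r in p.re..p.τ, (r : ℂ) = (p.τ ^ 2 - p.re ^ 2) / 2 := by
      rw [intervalIntegral.integral_ofReal, integral_id]
      push_cast
      ring
    simp_rw [mul_sub, mul_one]
    rw [intervalIntegral.integral_sub ((hc k).intervalIntegrable _ _)
      (Complex.continuous_ofReal.intervalIntegrable _ _), h2,
      hp.sum_cfTerm_sub (hp.lobePeak_ne_zero hk) hq]
    ring
  have h3 : ∫ r in p.re..p.τ, (r : ℂ) * (p.pointCF q r - 1) =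
      6 / (Real.pi * p.N) * ∑ k ∈ Finset.range (p.kmax + 1),
        ∫ r in p.re..p.τ, (r : ℂ) * (lobeMean p.m (p.cfArgIm k q r) - 1) := by
    rw [← intervalIntegral.integral_finsetSum, ← intervalIntegral.integral_const_mul]
    · refine intervalIntegral.integral_congr fun r _ => ?_
      simp only [pointCF, add_sub_cancel_left]
      rw [mul_left_comm, Finset.mul_sum]
    · intro k _
      refine Continuous.intervalIntegrable ?_ _ _
      simp_rw [mul_sub, mul_one]
      exact (hc k).sub Complex.continuous_ofReal
  rw [h3, Finset.sum_congr rfl h1, Finset.sum_sub_distrib, ← Finset.mul_sum, Finset.sum_const,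
    Finset.card_range]
  have hπ : (Real.pi : ℂ) ≠ 0 := Complex.ofReal_ne_zero.mpr Real.pi_ne_zero
  simp only [nsmul_eq_mul]
  push_cast
  field_simp
  ring

/-- The exposure as a function of the numbered base stations and their marks. -/
def markSum (p : NetworkParams)
    (w : (ℕ × (ℕ → EuclideanSpace ℝ (Fin 2))) × (ℕ → ℝ × ℂ)) : ℝ :=
  ∑ i ∈ Finset.range w.1.1,
    p.Sbar ‖w.1.2 i‖ * multiCosGain p.N p.kmax (w.2 i).1 * ‖(w.2 i).2‖ ^ 2

lemma Admissible.measurable_markSum (hp : p.Admissible) : Measurable p.markSum := by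
  refine measurable_comp_of_countable (n := fun w => w.1.1)
    (F := fun k (w : (ℕ × (ℕ → EuclideanSpace ℝ (Fin 2))) × (ℕ → ℝ × ℂ)) =>
      ∑ i ∈ Finset.range k,
        p.Sbar ‖w.1.2 i‖ * multiCosGain p.N p.kmax (w.2 i).1 * ‖(w.2 i).2‖ ^ 2)
    (measurable_fst.comp measurable_fst) fun k => Finset.measurable_fun_sum _ fun i _ => ?_
  have h1 : Measurable fun w : (ℕ × (ℕ → EuclideanSpace ℝ (Fin 2))) × (ℕ → ℝ × ℂ) => w.1.2 i :=
    (measurable_pi_apply i).comp (measurable_snd.comp measurable_fst)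
  have h2 : Measurable fun w : (ℕ × (ℕ → EuclideanSpace ℝ (Fin 2))) × (ℕ → ℝ × ℂ) => w.2 i :=
    (measurable_pi_apply i).comp measurable_snd
  exact ((hp.continuous_Sbar.measurable.comp h1.norm).mul
    ((measurable_multiCosGain _ _).comp h2.fst)).mul (h2.snd.norm.pow_const 2)

/-! ### Law of the exposure: transform, mean and atoms -/

namespace IsNetwork

variable {Ω : Type*} [MeasurableSpace Ω] {μ : Measure Ω} {n : Ω → ℕ}
  {X : ℕ → Ω → EuclideanSpace ℝ (Fin 2)} {ξ : ℕ → Ω → ℝ} {h : ℕ → Ω → ℂ}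

lemma measurable_fading (hnet : p.IsNetwork μ n X ξ h) (i : ℕ) :
    Measurable fun ω => ‖h i ω‖ ^ 2 :=
  (hnet.measurable_channel i).norm.pow_const 2

lemma measurable_gain (hnet : p.IsNetwork μ n X ξ h) (i : ℕ) :
    Measurable fun ω => multiCosGain p.N p.kmax (ξ i ω) :=
  (measurable_multiCosGain _ _).comp (hnet.measurable_angle i)

lemma integral_angle (hnet : p.IsNetwork μ n X ξ h) (i : ℕ) {f : ℝ → ℂ} (hf : Measurable f) :
    ∫ ω, f (ξ i ω) ∂μ =
      ((3 / (2 * Real.pi) : ℝ) : ℂ) * ∫ φ in (-(Real.pi / 3))..(Real.pi / 3), f φ := by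
  have hπ := Real.pi_pos
  rw [← integral_map (hnet.measurable_angle i).aemeasurable hf.aestronglyMeasurable,
    show μ.map (ξ i) = _ from hnet.angle_law i, ProbabilityTheory.cond, integral_smul_measure,
    Real.volume_Ico, intervalIntegral.integral_of_le (by linarith), integral_Ico_eq_integral_Ioc,
    ENNReal.toReal_inv, ENNReal.toReal_ofReal (by linarith), Complex.real_smul]
  congr 2
  field_simp
  ring

/-- The exposure when the base stations and the marks are taken from independent copies. -/
def splitExposure (p : NetworkParams) (n : Ω → ℕ) (X : ℕ → Ω → EuclideanSpace ℝ (Fin 2))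
    (ξ : ℕ → Ω → ℝ) (h : ℕ → Ω → ℂ) (z : Ω × Ω) : ℝ :=
  ∑ i ∈ Finset.range (n z.1),
    p.Sbar ‖X i z.1‖ * multiCosGain p.N p.kmax (ξ i z.2) * ‖h i z.2‖ ^ 2

lemma measurable_exposure (hp : p.Admissible) (hnet : p.IsNetwork μ n X ξ h) :
    Measurable (p.exposure n X ξ h) := by
  have hS := hp.continuous_Sbar.measurable
  have hX := hnet.poisson.measurable_point
  have hG := hnet.measurable_gain
  have hg := hnet.measurable_fading
  exact measurable_comp_of_countable (F := fun k ω => ∑ i ∈ Finset.range k,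
    p.Sbar ‖X i ω‖ * multiCosGain p.N p.kmax (ξ i ω) * ‖h i ω‖ ^ 2) hnet.poisson.measurable_card
    fun k => Finset.measurable_fun_sum _ fun i _ =>
      ((hS.comp (hX i).norm).mul (hG i)).mul (hg i)

lemma measurable_splitExposure (hp : p.Admissible) (hnet : p.IsNetwork μ n X ξ h) :
    Measurable (splitExposure p n X ξ h) := by
  have hS := hp.continuous_Sbar.measurable
  have hX := hnet.poisson.measurable_point
  have hG := hnet.measurable_gain
  have hg := hnet.measurable_fading
  exact measurable_comp_of_countable (F := fun k (z : Ω × Ω) => ∑ i ∈ Finset.range k,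
    p.Sbar ‖X i z.1‖ * multiCosGain p.N p.kmax (ξ i z.2) * ‖h i z.2‖ ^ 2)
    (hnet.poisson.measurable_card.comp measurable_fst)
    fun k => Finset.measurable_fun_sum _ fun i _ =>
      ((hS.comp ((hX i).comp measurable_fst).norm).mul ((hG i).comp measurable_snd)).mul
        ((hg i).comp measurable_snd)

lemma iIndepFun_marks (hnet : p.IsNetwork μ n X ξ h) (a : ℕ → ℝ) :
    iIndepFun (fun i ω => a i * multiCosGain p.N p.kmax (ξ i ω) * ‖h i ω‖ ^ 2) μ := by
  have hG := measurable_multiCosGain p.N p.kmax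
  exact hnet.marks_indep.comp (fun i (w : ℝ × ℂ) => a i * multiCosGain p.N p.kmax w.1 * ‖w.2‖ ^ 2)
    fun i => by fun_prop

lemma measurable_mark (hnet : p.IsNetwork μ n X ξ h) (a : ℕ → ℝ) (i : ℕ) :
    Measurable fun ω => a i * multiCosGain p.N p.kmax (ξ i ω) * ‖h i ω‖ ^ 2 :=
  ((hnet.measurable_gain i).const_mul (a i)).mul (hnet.measurable_fading i)

lemma integral_fading (hnet : p.IsNetwork μ n X ξ h) (i : ℕ) :
    ∫ ω, ‖h i ω‖ ^ 2 ∂μ = ∫ x, x ∂(gammaMeasure p.m p.m) :=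
  (hnet.fading_law i).integral_eq

lemma integrable_fading (hp : p.Admissible) (hnet : p.IsNetwork μ n X ξ h) (i : ℕ) :
    Integrable (fun ω => ‖h i ω‖ ^ 2) μ := by
  have := integrable_id_gammaMeasure hp.m_pos
  rw [← (hnet.fading_law i).map_eq] at this
  exact this.comp_aemeasurable (hnet.fading_law i).aemeasurable

theorem exposureCDF_eq (hp : p.Admissible) (hnet : p.IsNetwork μ n X ξ h) (T : ℝ) :
    p.exposureCDF μ n X ξ h T = (μ.map (p.exposure n X ξ h)).real (Set.Iio T) := by
  rw [map_measureReal_apply (measurable_exposure hp hnet) measurableSet_Iio]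
  rfl

variable [IsProbabilityMeasure μ]

/-- The characteristic function of a single summand of the exposure. -/
lemma integral_cexp_mark (hp : p.Admissible) (hnet : p.IsNetwork μ n X ξ h) (i : ℕ) (q r : ℝ) :
    ∫ ω, Complex.exp (Complex.I * ((q * (p.Sbar r * multiCosGain p.N p.kmax (ξ i ω) *
      ‖h i ω‖ ^ 2) : ℝ) : ℂ)) ∂μ = p.pointCF q r := by
  have hm : (p.m : ℝ) ≠ 0 := by have := hp.m_pos; positivity
  have hind : IndepFun (ξ i) (fun ω => ‖h i ω‖ ^ 2) μ :=
    (hnet.angle_indep_channel i).comp (φ := id) (ψ := fun c : ℂ => ‖c‖ ^ 2) measurable_id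
      (by fun_prop)
  have hξ := hnet.measurable_angle i
  have hg := hnet.measurable_fading i
  have hmap := (indepFun_iff_map_prod_eq_prod_map_map hξ.aemeasurable hg.aemeasurable).mp hind
  rw [(hnet.fading_law i).map_eq] at hmap
  have := Measure.isProbabilityMeasure_map (μ := μ) hξ.aemeasurable
  have := isProbabilityMeasure_gammaMeasure (a := p.m) (r := p.m)
    (by have := hp.m_pos; positivity) (by have := hp.m_pos; positivity)
  let F : ℝ × ℝ → ℂ := fun z => Complex.exp (Complex.I * ((q * (p.Sbar r *
    multiCosGain p.N p.kmax z.1 * z.2) : ℝ) : ℂ))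
  have hF : Measurable F := by
    have := measurable_multiCosGain p.N p.kmax
    fun_prop
  have hF1 : ∀ z, ‖F z‖ = 1 := fun z => by
    simp only [F]
    rw [mul_comm, Complex.norm_exp_ofReal_mul_I]
  have h1 : ∫ ω, F (ξ i ω, ‖h i ω‖ ^ 2) ∂μ =
      ∫ φ, ∫ x, F (φ, x) ∂(gammaMeasure p.m p.m) ∂(μ.map (ξ i)) := by
    rw [← integral_map (φ := fun ω => (ξ i ω, ‖h i ω‖ ^ 2)) (hξ.prodMk hg).aemeasurable
      hF.aestronglyMeasurable, hmap, integral_prod]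
    exact Integrable.mono' (integrable_const (1 : ℝ)) hF.aestronglyMeasurable
      (Eventually.of_forall fun z => (hF1 z).le)
  -- The gamma transform as a function of the gain $u$; integrating out the fading first leaves only
  -- the average of `g` over the antenna pattern.
  let g : ℝ → ℂ := fun u => ((1 - Complex.I * ((q * p.Sbar r / p.m * u : ℝ) : ℂ)) ^ p.m)⁻¹
  have hgc : Continuous g := (continuous_inv_one_sub_I_mul_pow p.m).comp (by fun_prop)
  have h2 : ∀ φ, ∫ x, F (φ, x) ∂(gammaMeasure p.m p.m) = g (multiCosGain p.N p.kmax φ) := by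
    intro φ
    simp only [g]
    rw [← integral_cexp_gammaMeasure hp.m_pos]
    refine integral_congr_ae (Eventually.of_forall fun x => ?_)
    simp only [F]
    congr 3
    field_simp
  have hgG : Measurable fun φ => g (multiCosGain p.N p.kmax φ) :=
    hgc.measurable.comp (measurable_multiCosGain _ _)
  have hg1 : ∀ u, ‖g u‖ ≤ 1 := fun u => norm_inv_one_sub_I_mul_pow_le _ _
  have h3 := integral_multiCosGain hp.lobes hgc hg1 (by simp [g])
  have h4 : ∫ ω, (g (multiCosGain p.N p.kmax (ξ i ω)) - 1) ∂μ = p.pointCF q r - 1 := by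
    rw [hnet.integral_angle i (hgG.sub_const 1), h3]
    unfold pointCF
    have hmean : ∀ k, sinSqMean g (lobePeak p.N k) = lobeMean p.m (p.cfArgIm k q r) := by
      intro k
      unfold sinSqMean lobeMean
      congr 1
      refine intervalIntegral.integral_congr fun θ _ => ?_
      simp only [g, cfArgIm]
      congr 4
      push_cast
      ring
    simp_rw [hmean]
    push_cast
    ring
  have hgi : Integrable (fun ω => g (multiCosGain p.N p.kmax (ξ i ω))) μ :=
    Integrable.mono' (integrable_const (1 : ℝ)) (hgG.comp hξ).aestronglyMeasurable
      (Eventually.of_forall fun ω => hg1 _)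
  rw [integral_sub hgi (integrable_const _), integral_const, probReal_univ, one_smul,
    sub_left_inj] at h4
  rw [← h4]
  change ∫ ω, F (ξ i ω, ‖h i ω‖ ^ 2) ∂μ = _
  rw [h1]
  simp_rw [h2]
  rw [integral_map hξ.aemeasurable hgG.aestronglyMeasurable]

/-- It is a mean of unimodular numbers. Any index would serve in place of $0$, since the value does
not depend on it. -/
lemma norm_pointCF_le (hp : p.Admissible) (hnet : p.IsNetwork μ n X ξ h) (q r : ℝ) :
    ‖p.pointCF q r‖ ≤ 1 := by
  rw [← hnet.integral_cexp_mark hp 0 q r]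
  refine (norm_integral_le_of_norm_le_const (C := 1) (Eventually.of_forall fun ω => ?_)).trans
    (by simp)
  rw [mul_comm, Complex.norm_exp_ofReal_mul_I]

/-- Independence makes the joint law of stations and marks a product, and the exposure is the
measurable function `markSum` of the pair. Afterwards, freezing the stations means fixing the first
coordinate. -/
lemma identDistrib_exposure (hp : p.Admissible) (hnet : p.IsNetwork μ n X ξ h) :
    IdentDistrib (p.exposure n X ξ h) (splitExposure p n X ξ h) μ (μ.prod μ) := by
  have hP : Measurable fun ω => (n ω, fun i => X i ω) :=
    hnet.poisson.measurable_card.prodMk (measurable_pi_lambda _ hnet.poisson.measurable_point)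
  have hQ : Measurable fun ω i => (ξ i ω, h i ω) :=
    measurable_pi_lambda _ fun i => (hnet.measurable_angle i).prodMk (hnet.measurable_channel i)
  have hid : IdentDistrib (fun ω => ((n ω, fun i => X i ω), fun i => (ξ i ω, h i ω)))
      (fun z : Ω × Ω => ((n z.1, fun i => X i z.1), fun i => (ξ i z.2, h i z.2)))
      μ (μ.prod μ) := by
    refine ⟨(hP.prodMk hQ).aemeasurable,
      ((hP.comp measurable_fst).prodMk (hQ.comp measurable_snd)).aemeasurable, ?_⟩
    rw [(indepFun_iff_map_prod_eq_prod_map_map hP.aemeasurable hQ.aemeasurable).mp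
      hnet.points_indep_marks, Measure.map_prod_map _ _ hP hQ]
    rfl
  exact hid.comp hp.measurable_markSum

/-- For frozen stations the mark integral factorizes into values of `pointCF`; the outer integral is
then the Poisson generating functional. -/
theorem charFun_exposure (hp : p.Admissible) (hnet : p.IsNetwork μ n X ξ h) {q : ℝ} (hq : q ≠ 0) :
    charFun (μ.map (p.exposure n X ξ h)) q = p.exposureCF q := by
  have hS' := measurable_splitExposure hp hnet
  rw [(identDistrib_exposure hp hnet).map_eq, charFun_apply_real,
    integral_map hS'.aemeasurable (by fun_prop), integral_prod]
  · rw [← hp.exp_integral_pointCF hq, ← hnet.poisson.integral_prod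
      (ψ := fun x => p.pointCF q ‖x‖) ((hp.continuous_pointCF q).comp continuous_norm).measurable
      fun x => norm_pointCF_le hp hnet q ‖x‖]
    refine integral_congr_ae (Eventually.of_forall fun ω => ?_)
    have hprod : ∀ ω', Complex.exp (q * splitExposure p n X ξ h (ω, ω') * Complex.I) =
        ∏ i : Fin (n ω), Complex.exp (Complex.I * ((q * (p.Sbar ‖X i ω‖ *
          multiCosGain p.N p.kmax (ξ i ω') * ‖h i ω'‖ ^ 2) : ℝ) : ℂ)) := by
      intro ω'
      rw [← Complex.exp_sum, ← Finset.mul_sum, ← Complex.ofReal_sum, ← Finset.mul_sum,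
        Fin.sum_univ_eq_sum_range (fun i => p.Sbar ‖X i ω‖ *
          multiCosGain p.N p.kmax (ξ i ω') * ‖h i ω'‖ ^ 2) (n ω)]
      simp only [splitExposure]
      congr 1
      push_cast
      ring
    simp only [hprod]
    have hind := (hnet.iIndepFun_marks (fun i => p.Sbar ‖X i ω‖)).precomp
      (Fin.val_injective (n := n ω))
    rw [hind.integral_fun_prod_comp (f := fun _ (x : ℝ) =>
      Complex.exp (Complex.I * ((q * x : ℝ) : ℂ)))
      (fun i => (hnet.measurable_mark (fun i => p.Sbar ‖X i ω‖) i).aemeasurable)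
      fun i => Continuous.aestronglyMeasurable (by fun_prop),
      ← Fin.prod_univ_eq_prod_range (fun i => p.pointCF q ‖X i ω‖) (n ω)]
    exact Finset.prod_congr rfl fun i _ => hnet.integral_cexp_mark hp i q _
  · refine Integrable.mono' (integrable_const (1 : ℝ))
      (Measurable.aestronglyMeasurable (by fun_prop)) (Eventually.of_forall fun z => ?_)
    rw [← Complex.ofReal_mul, Complex.norm_exp_ofReal_mul_I]

/-- The power density is at most $\bar S_r(0)$ and the gain is bounded, so the sum of the fadings
dominates. Its mean is the mean number of stations times the gamma mean. -/
theorem integrable_exposure (hp : p.Admissible) (hnet : p.IsNetwork μ n X ξ h) :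
    Integrable (p.exposure n X ξ h) μ := by
  obtain ⟨C, hC⟩ := exists_multiCosGain_le p.N p.kmax
  have hC0 : 0 ≤ C := (multiCosGain_nonneg _ _ 0).trans (hC 0)
  have hS0 := (hp.Sbar_pos 0).le
  rw [(identDistrib_exposure hp hnet).integrable_iff]
  have hmeas : Measurable fun z : Ω × Ω => ∑ i ∈ Finset.range (n z.1), ‖h i z.2‖ ^ 2 :=
    measurable_comp_of_countable (F := fun k (z : Ω × Ω) => ∑ i ∈ Finset.range k, ‖h i z.2‖ ^ 2)
      (hnet.poisson.measurable_card.comp measurable_fst)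
      fun k => Finset.measurable_fun_sum _ fun i _ =>
        (hnet.measurable_fading i).comp measurable_snd
  have hint : Integrable (fun z : Ω × Ω => ∑ i ∈ Finset.range (n z.1), ‖h i z.2‖ ^ 2)
      (μ.prod μ) := by
    rw [integrable_prod_iff hmeas.aestronglyMeasurable]
    constructor
    · exact Eventually.of_forall fun ω => integrable_finsetSum (Finset.range (n ω)) fun i _ =>
        hnet.integrable_fading hp i
    · refine (hnet.poisson.integrable_card.mul_const
        (∫ x, x ∂(gammaMeasure p.m p.m))).congr (Eventually.of_forall fun ω => ?_)
      have : ∀ ω', ‖∑ i ∈ Finset.range (n ω), ‖h i ω'‖ ^ 2‖ =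
          ∑ i ∈ Finset.range (n ω), ‖h i ω'‖ ^ 2 := fun ω' =>
        Real.norm_of_nonneg (Finset.sum_nonneg fun i _ => by positivity)
      simp only [this]
      rw [integral_finsetSum _ fun i _ => hnet.integrable_fading hp i]
      simp_rw [hnet.integral_fading]
      simp
  refine (hint.const_mul (p.Sbar 0 * C)).mono'
    (measurable_splitExposure hp hnet).aestronglyMeasurable (Eventually.of_forall fun z => ?_)
  rw [Finset.mul_sum]
  refine (norm_sum_le _ _).trans (Finset.sum_le_sum fun i _ => ?_)
  rw [norm_mul, norm_mul, Real.norm_of_nonneg (hp.Sbar_pos _).le,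
    Real.norm_of_nonneg (multiCosGain_nonneg _ _ _), Real.norm_of_nonneg (sq_nonneg _)]
  have h1 := hp.Sbar_le ‖X i z.1‖
  have h2 := multiCosGain_nonneg p.N p.kmax (ξ i z.2)
  gcongr
  exact hC _

theorem map_exposure_singleton (hp : p.Admissible) (hnet : p.IsNetwork μ n X ξ h) {T : ℝ}
    (hT : T ≠ 0) : μ.map (p.exposure n X ξ h) {T} = 0 := by
  have hS' := measurable_splitExposure hp hnet
  rw [(identDistrib_exposure hp hnet).map_eq, Measure.map_apply hS' (measurableSet_singleton T),
    Measure.measure_prod_null (hS' (measurableSet_singleton T))]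
  refine Eventually.of_forall fun ω => ?_
  refine measure_sum_eq_zero (hnet.measurable_mark fun i => p.Sbar ‖X i ω‖)
    (hnet.iIndepFun_marks _) (fun i x hx => ?_) (n ω) hT
  refine measure_mul_eq_zero ((hnet.measurable_gain i).const_mul _) (hnet.measurable_fading i)
    ?_ (fun y => ?_) hx
  · have hG := measurable_multiCosGain p.N p.kmax
    exact (hnet.angle_indep_channel i).comp
      (φ := fun x => p.Sbar ‖X i ω‖ * multiCosGain p.N p.kmax x) (ψ := fun c : ℂ => ‖c‖ ^ 2)
      (by fun_prop) (by fun_prop)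
  · have := (hnet.fading_law i).measure_eq (p := fun x => x = y)
      (measurableSet_eq_fun measurable_id measurable_const)
    rw [this]
    exact gammaMeasure_singleton _ _ _

/-- Tower property. It relies on `pointSigma` being a sub-σ-algebra, without which the conditional
expectation would default to $0$. -/
theorem condCDFMoment_one (hp : p.Admissible) (hnet : p.IsNetwork μ n X ξ h) (T : ℝ) :
    p.condCDFMoment μ 1 n X ξ h T = p.exposureCDF μ n X ξ h T := by
  have hs : MeasurableSet {ω | p.exposure n X ξ h ω < T} :=
    measurableSet_lt (measurable_exposure hp hnet) measurable_const
  unfold condCDFMoment condExposureCDF exposureCDF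
  simp only [pow_one]
  rw [integral_condExp (pointSigma_le hnet.poisson.measurable_card hnet.poisson.measurable_point),
    integral_indicator_const _ hs, smul_eq_mul, mul_one]

end IsNetwork

end NetworkParams

end

theorem theorem2 (p : NetworkParams) (hp : p.Admissible)
    {Ω : Type*} [MeasurableSpace Ω] (μ : Measure Ω) [IsProbabilityMeasure μ]
    (n : Ω → ℕ) (X : ℕ → Ω → EuclideanSpace ℝ (Fin 2)) (ξ : ℕ → Ω → ℝ) (h : ℕ → Ω → ℂ)
    (hnet : p.IsNetwork μ n X ξ h) :
    -- the first moment of the conditional CDF is the unconditional CDF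
    (∀ T : ℝ, p.condCDFMoment μ 1 n X ξ h T = p.exposureCDF μ n X ξ h T) ∧
    -- the characteristic function of the exposure in closed form
    (∀ q : ℝ, q ≠ 0 → charFun (μ.map (p.exposure n X ξ h)) q = p.exposureCF q) ∧
    -- the inversion integral, improper at infinity
    (∀ T : ℝ, T ≠ 0 →
      (∀ R : ℝ, 0 < R → IntervalIntegrable
        (fun q : ℝ => (p.exposureCF q * Complex.exp (-Complex.I * q * T)).im * q⁻¹)
        volume 0 R) ∧
      Tendsto (fun R : ℝ => 1 / 2 - 1 / Real.pi *
          ∫ q in (0 : ℝ)..R, (p.exposureCF q * Complex.exp (-Complex.I * q * T)).im * q⁻¹)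
        atTop (𝓝 (p.condCDFMoment μ 1 n X ξ h T))) := by
  have hmeas := hnet.measurable_exposure hp
  have hprob := Measure.isProbabilityMeasure_map (μ := μ) hmeas.aemeasurable
  have hint : Integrable (fun x : ℝ => x) (μ.map (p.exposure n X ξ h)) :=
    (integrable_map_measure (by fun_prop) hmeas.aemeasurable).mpr (hnet.integrable_exposure hp)
  refine ⟨hnet.condCDFMoment_one hp, fun q hq => hnet.charFun_exposure hp hq, fun T hT => ?_⟩
  -- At $q=0$ the closed form need not be the characteristic function, but there both integrands are
  -- $0$ by the convention $0^{-1}=0$.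
  have hfun : (fun q : ℝ => (p.exposureCF q * Complex.exp (-Complex.I * q * T)).im * q⁻¹) =
      fun q : ℝ => (charFun (μ.map (p.exposure n X ξ h)) q *
        Complex.exp (-Complex.I * q * T)).im * q⁻¹ := by
    funext q
    rcases eq_or_ne q 0 with rfl | hq
    · simp
    · rw [hnet.charFun_exposure hp hq]
  rw [hfun, hnet.condCDFMoment_one hp, hnet.exposureCDF_eq hp]
  exact ⟨fun R hR => intervalIntegrable_gilPelaez hint hR T,
    tendsto_gilPelaez hint (hnet.map_exposure_singleton hp hT)⟩
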